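/- Let $T_1<T_2$, let $p,q,m,n\in C[T_1,T_2]$ with $p>0$ and $q\ge 0$ on $[T_1,T_2]$, and with $m\not\equiv0$, $n\not\equiv0$ (the weights $m$ and $n$ may change sign). For $(a,b)\in\mathbb R^2$ consider the Neumann problem $$-(p(t)u')'+q(t)u = a\,m(t)\,u^+ - b\,n(t)\,u^-\ \text{ in } (T_1,T_2),\qquad u'(T_1)=0=u'(T_2),$$ where $u^\pm=\max\{\pm u,0\}$. For $k\ge 1$ let $C_k^>$ (resp. $C_k^<$) be the set of those $(a,b)\in\mathbb R^2$ for which this problem has a nontrivial solution $u$ with exactly $k$ zeros in $(T_1,T_2)$ and with $u(T_2)>0$ (resp. $u(T_2)<0$). Write $\mathbb R_+=[0,+\infty)$ and $\mathbb R_-=(-\infty,0]$. Let $k\ge1$. 1. For all $\epsilon_1,\epsilon_2\in\{+,-\}$ the following two assertions are equivalent: (i) $C_k^>\cap(\mathbb R_{\epsilon_1}\times\mathbb R_{\epsilon_2})$ and $C_k^<\cap(\mathbb R_{\epsilon_1}\times\mathbb R_{\epsilon_2})$ are both nonempty; (ii) at least one of $C_{k+1}^>\cap(\mathbb R_{\epsilon_1}\times\mathbb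 R_{\epsilon_2})$ and $C_{k+1}^<\cap(\mathbb R_{\epsilon_1}\times\mathbb R_{\epsilon_2})$ is nonempty. 2. In each of the quadrants $\mathbb R_+\times\mathbb R_+$ and $\mathbb R_-\times\mathbb R_+$, both $C_k^>$ and $C_k^<$ lie strictly below $C_{k+1}^>$ and strictly below $C_{k+1}^<$: if $Q$ is one of these quadrants, $S\in\{C_{k+1}^>,C_{k+1}^<\}$, $T\in\{C_k^>,C_k^<\}$ and $(a,b)\in S\cap Q$, then there is a $b'$ with $(a,b')\in T\cap Q$, and every such $b'$ satisfies $b'<b$. In each of the quadrants $\mathbb R_+\times\mathbb R_-$ and $\mathbb R_-\times\mathbb R_-$, both $C_k^>$ and $C_k^<$ lie strictly above $C_{k+1}^>$ and strictly above $C_{k+1}^<$, in the same sense with $b'>b$ instead of $b'<b$. -/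

import Mathlib

namespace Fucik

/-- The two signs `+` and `-`. -/
inductive Sgn where
  | pos : Sgn
  | neg : Sgn

/-- The half line `ℝ_+ = [0, +∞)` or `ℝ_- = (-∞, 0]`. -/
def halfLine : Sgn → Set ℝ
  | Sgn.pos => Set.Ici 0
  | Sgn.neg => Set.Iic 0

/-- The quadrant `ℝ_{ε₁} × ℝ_{ε₂}` of the `(a, b)`-plane. -/
def quadrant (ε₁ ε₂ : Sgn) : Set (ℝ × ℝ) :=
  halfLine ε₁ ×ˢ halfLine ε₂

/-- `x` is nonzero and has the given sign. -/
def HasSign : Sgn → ℝ → Prop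
  | Sgn.pos, x => 0 < x
  | Sgn.neg, x => x < 0

/-- `u` is a classical solution of the Neumann problem
`-(p u')' + q u = a m u⁺ - b n u⁻` in `(T₁, T₂)`, `u'(T₁) = 0 = u'(T₂)`, with
`u⁺ = max u 0` and `u⁻ = max (-u) 0`. Since `p` is only continuous, this means that `u` is
continuously differentiable on `[T₁, T₂]`, with derivative `v`, and that `p v` is
differentiable in `(T₁, T₂)`. -/
def IsSolution (T₁ T₂ : ℝ) (p q m n : ℝ → ℝ) (a b : ℝ) (u : ℝ → ℝ) : Prop :=
  ∃ v : ℝ → ℝ,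
    (∀ t ∈ Set.Icc T₁ T₂, HasDerivWithinAt u (v t) (Set.Icc T₁ T₂) t) ∧
    ContinuousOn v (Set.Icc T₁ T₂) ∧
    (∀ t ∈ Set.Ioo T₁ T₂, ∃ w : ℝ, HasDerivAt (fun s => p s * v s) w t ∧
      -w + q t * u t = a * m t * max (u t) 0 - b * n t * max (-u t) 0) ∧
    v T₁ = 0 ∧ v T₂ = 0

/-- The set `C_k^>` (for `σ = +`) or `C_k^<` (for `σ = -`): the pairs `(a, b)` for which the
problem has a nontrivial solution `u` with exactly `k` zeros in `(T₁, T₂)` and with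
`u(T₂) > 0`, respectively `u(T₂) < 0` (which makes `u` nontrivial). -/
def curve (T₁ T₂ : ℝ) (p q m n : ℝ → ℝ) (σ : Sgn) (k : ℕ) : Set (ℝ × ℝ) :=
  {x | ∃ u : ℝ → ℝ, IsSolution T₁ T₂ p q m n x.1 x.2 u ∧
    {t | t ∈ Set.Ioo T₁ T₂ ∧ u t = 0}.encard = (k : ℕ∞) ∧ HasSign σ (u T₂)}

/-- `S` lies strictly above `T`: each vertical line through a point of `S` meets `T`, and it
does so only strictly below that point. -/
def LiesStrictlyAbove (S T : Set (ℝ × ℝ)) : Prop :=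
  ∀ a b : ℝ, (a, b) ∈ S → (∃ b', (a, b') ∈ T) ∧ ∀ b', (a, b') ∈ T → b' < b

/-- `S` lies strictly below `T`: each vertical line through a point of `S` meets `T`, and it
does so only strictly above that point. -/
def LiesStrictlyBelow (S T : Set (ℝ × ℝ)) : Prop :=
  ∀ a b : ℝ, (a, b) ∈ S → (∃ b', (a, b') ∈ T) ∧ ∀ b', (a, b') ∈ T → b < b'

end Fucik

/-! Write u = R cos θ, p u' = -R sin θ. The angle satisfies a scalar equation that no longer
contains R, the Neumann conditions say that θ is a multiple of π at both ends, and at a zero of u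
one has θ' = 1/p > 0, so zeros are crossed upward only. Hence k zeros means a total rise of kπ, and
a curve is a shooting condition: the angle starting at `endAngle σ - kπ` ends at `endAngle σ`
(`mem_curve_iff`). Changing the sign of a together with m, or of b together with n, reduces every
quadrant to a, b ≥ 0.

The difficulty is that n may change sign, so θ need not be monotone in b. Where u < 0, however,
dividing the equation by b leaves the weight fixed and replaces p, q by p/b, q/b, which decrease in
b; this rescaling multiplies tan θ by a constant. Since q ≥ 0, the rescaled angle is a subsolution
for a larger b (`halfStretch_le`), and the rescaling fixes all multiples of π/2. So levels once
passed remain passed when b grows (`levels_mono_neg`), and likewise for a (`levels_mono_pos`).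

Ordering: at a point of a (k+1)-curve, the angle shot for the k-curve overshoots
(`exists_isAngle_endAngle_lt`). At b = 0 it falls short, because q ≥ 0 makes odd multiples of π
barriers. Continuity in b gives a point below, and persistence of levels excludes any point at the
same height or above. This also gives (ii) ⇒ (i).

For (i) ⇒ (ii), a point of `C_k^>` gives a time s with m(s) > 0 by which the angle has entered its
last positive half turn; a point of `C_k^<` gives such a time r with n(r) > 0. If s ≤ r, enlarging a
and b keeps the level at s and forces a half turn right after s, then another after a point just
beyond r, so the angle overshoots the target of `C_{k+1}^<`, and lowering b hits it. If r ≤ s the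
signs are exchanged. -/

namespace Fucik
open Set Filter Topology

/-! ### The Prüfer angle equation: coefficients, bounds and symmetries -/

/-- The right-hand side of the Prüfer angle equation `θ' = field p q f g t θ`, attached to
`-(p u')' + q u = f u⁺ - g u⁻` by `u = R cos θ`, `p u' = -R sin θ`. -/
noncomputable def field (p q f g : ℝ → ℝ) (t x : ℝ) : ℝ :=
  Real.sin x ^ 2 / p t + f t * max (Real.cos x) 0 ^ 2 + g t * max (-Real.cos x) 0 ^ 2
    - q t * Real.cos x ^ 2

/-- `θ` is a Prüfer angle on `[α, β]`. -/
def IsAngle (p q f g : ℝ → ℝ) (α β : ℝ) (θ : ℝ → ℝ) : Prop :=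
  ∀ t ∈ Icc α β, HasDerivWithinAt θ (field p q f g t (θ t)) (Icc α β) t

/-- Continuous coefficients on `[α, β]` with `p > 0`. -/
structure Coeffs (p q f g : ℝ → ℝ) (α β : ℝ) : Prop where
  p_cont : ContinuousOn p (Icc α β)
  q_cont : ContinuousOn q (Icc α β)
  f_cont : ContinuousOn f (Icc α β)
  g_cont : ContinuousOn g (Icc α β)
  p_pos : ∀ t ∈ Icc α β, 0 < p t

variable {p q f g : ℝ → ℝ} {α β : ℝ}

theorem Coeffs.mono (h : Coeffs p q f g α β) {α' β' : ℝ} (hα : α ≤ α') (hβ : β' ≤ β) :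
    Coeffs p q f g α' β' := by
  have hs : Icc α' β' ⊆ Icc α β := Icc_subset_Icc hα hβ
  exact ⟨h.p_cont.mono hs, h.q_cont.mono hs, h.f_cont.mono hs, h.g_cont.mono hs,
    fun t ht => h.p_pos t (hs ht)⟩

theorem Coeffs.swap (h : Coeffs p q f g α β) : Coeffs p q g f α β :=
  ⟨h.p_cont, h.q_cont, h.g_cont, h.f_cont, h.p_pos⟩

theorem Coeffs.of_smul {m n : ℝ → ℝ} (h : Coeffs p q m n α β) (a b : ℝ) :
    Coeffs p q (fun t => a * m t) (fun t => b * n t) α β :=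
  ⟨h.p_cont, h.q_cont, continuousOn_const.mul h.f_cont, continuousOn_const.mul h.g_cont, h.p_pos⟩

theorem exists_abs_le_of_continuousOn {φ : ℝ → ℝ} (h : ContinuousOn φ (Icc α β)) :
    ∃ C, 0 ≤ C ∧ ∀ t ∈ Icc α β, |φ t| ≤ C := by
  obtain ⟨C, hC⟩ := isCompact_Icc.exists_bound_of_continuousOn h
  exact ⟨max C 0, le_max_right _ _, fun t ht => (hC t ht).trans (le_max_left _ _)⟩

theorem abs_sq_sub_sq_le {x y d : ℝ} (hx : |x| ≤ 1) (hy : |y| ≤ 1) (h : |x - y| ≤ d) :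
    |x ^ 2 - y ^ 2| ≤ 2 * d := by
  have : x ^ 2 - y ^ 2 = (x + y) * (x - y) := by ring
  rw [this, abs_mul]
  have h1 : |x + y| ≤ 2 := (abs_add_le x y).trans (by linarith)
  exact mul_le_mul h1 h (abs_nonneg _) (by norm_num)

theorem abs_cos_sub_cos_le (x y : ℝ) : |Real.cos x - Real.cos y| ≤ |x - y| := by
  have := Real.lipschitzWith_cos.dist_le_mul x y
  simpa [Real.dist_eq] using this

theorem abs_sin_sub_sin_le (x y : ℝ) : |Real.sin x - Real.sin y| ≤ |x - y| := by
  have := Real.lipschitzWith_sin.dist_le_mul x y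
  simpa [Real.dist_eq] using this

theorem abs_max_zero_le_one {c : ℝ} (h : |c| ≤ 1) : |max c 0| ≤ 1 := by
  rw [abs_le] at *
  exact ⟨by linarith [le_max_right c 0], max_le h.2 (by norm_num)⟩

theorem exists_lipschitz_field (h : Coeffs p q f g α β) :
    ∃ L, 0 ≤ L ∧ ∀ t ∈ Icc α β, ∀ x y, |field p q f g t x - field p q f g t y| ≤ L * |x - y| := by
  obtain ⟨P, hP0, hP⟩ := exists_abs_le_of_continuousOn
    (φ := fun t => (p t)⁻¹) (h.p_cont.inv₀ fun t ht => (h.p_pos t ht).ne')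
  obtain ⟨Q, hQ0, hQ⟩ := exists_abs_le_of_continuousOn h.q_cont
  obtain ⟨F, hF0, hF⟩ := exists_abs_le_of_continuousOn h.f_cont
  obtain ⟨G, hG0, hG⟩ := exists_abs_le_of_continuousOn h.g_cont
  refine ⟨2 * (P + F + G + Q), by positivity, fun t ht x y => ?_⟩
  have e1 := abs_sq_sub_sq_le (Real.abs_sin_le_one x) (Real.abs_sin_le_one y)
    (abs_sin_sub_sin_le x y)
  have e2 := abs_sq_sub_sq_le (Real.abs_cos_le_one x) (Real.abs_cos_le_one y)
    (abs_cos_sub_cos_le x y)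
  have e3 := abs_sq_sub_sq_le (abs_max_zero_le_one (Real.abs_cos_le_one x))
    (abs_max_zero_le_one (Real.abs_cos_le_one y))
    ((abs_max_sub_max_le_abs _ _ _).trans (abs_cos_sub_cos_le x y))
  have e4 := abs_sq_sub_sq_le
    (abs_max_zero_le_one (c := -Real.cos x) (by simpa using Real.abs_cos_le_one x))
    (abs_max_zero_le_one (c := -Real.cos y) (by simpa using Real.abs_cos_le_one y))
    (d := |x - y|) ((abs_max_sub_max_le_abs (-Real.cos x) (-Real.cos y) 0).trans
      (by rw [neg_sub_neg, abs_sub_comm]; exact abs_cos_sub_cos_le x y))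
  have key : field p q f g t x - field p q f g t y
      = (p t)⁻¹ * (Real.sin x ^ 2 - Real.sin y ^ 2)
        + f t * (max (Real.cos x) 0 ^ 2 - max (Real.cos y) 0 ^ 2)
        + g t * (max (-Real.cos x) 0 ^ 2 - max (-Real.cos y) 0 ^ 2)
        - q t * (Real.cos x ^ 2 - Real.cos y ^ 2) := by
    simp only [field]; ring
  rw [key]
  have b1 := mul_le_mul (hP t ht) e1 (abs_nonneg _) hP0
  have b2 := mul_le_mul (hF t ht) e3 (abs_nonneg _) hF0
  have b3 := mul_le_mul (hG t ht) e4 (abs_nonneg _) hG0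
  have b4 := mul_le_mul (hQ t ht) e2 (abs_nonneg _) hQ0
  rw [← abs_mul] at b1 b2 b3 b4
  refine (abs_sub _ _).trans ?_
  have := abs_add_three ((p t)⁻¹ * (Real.sin x ^ 2 - Real.sin y ^ 2))
    (f t * (max (Real.cos x) 0 ^ 2 - max (Real.cos y) 0 ^ 2))
    (g t * (max (-Real.cos x) 0 ^ 2 - max (-Real.cos y) 0 ^ 2))
  linarith

theorem continuousOn_field (h : Coeffs p q f g α β) {θ : ℝ → ℝ} (hθ : ContinuousOn θ (Icc α β)) :
    ContinuousOn (fun t => field p q f g t (θ t)) (Icc α β) := by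
  have hs := Real.continuous_sin.comp_continuousOn hθ
  have hc := Real.continuous_cos.comp_continuousOn hθ
  have hc' : ContinuousOn (fun t => max (Real.cos (θ t)) 0) (Icc α β) := hc.sup continuousOn_const
  have hc'' : ContinuousOn (fun t => max (-Real.cos (θ t)) 0) (Icc α β) :=
    hc.neg.sup continuousOn_const
  exact ((((hs.pow 2).div h.p_cont fun t ht => (h.p_pos t ht).ne').add
    (h.f_cont.mul (hc'.pow 2))).add (h.g_cont.mul (hc''.pow 2))).sub (h.q_cont.mul (hc.pow 2))

theorem exists_bound_field (h : Coeffs p q f g α β) :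
    ∃ M, 0 ≤ M ∧ ∀ t ∈ Icc α β, ∀ x, |field p q f g t x| ≤ M := by
  obtain ⟨P, hP0, hP⟩ := exists_abs_le_of_continuousOn
    (φ := fun t => (p t)⁻¹) (h.p_cont.inv₀ fun t ht => (h.p_pos t ht).ne')
  obtain ⟨Q, hQ0, hQ⟩ := exists_abs_le_of_continuousOn h.q_cont
  obtain ⟨F, hF0, hF⟩ := exists_abs_le_of_continuousOn h.f_cont
  obtain ⟨G, hG0, hG⟩ := exists_abs_le_of_continuousOn h.g_cont
  refine ⟨P + F + G + Q, by positivity, fun t ht x => ?_⟩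
  have sq_le {y : ℝ} (hy : |y| ≤ 1) : |y ^ 2| ≤ 1 := by
    rw [abs_pow]; exact pow_le_one₀ (abs_nonneg _) hy
  have b1 := mul_le_mul (hP t ht) (sq_le (Real.abs_sin_le_one x)) (abs_nonneg _) hP0
  have b2 := mul_le_mul (hF t ht) (sq_le (abs_max_zero_le_one (Real.abs_cos_le_one x)))
    (abs_nonneg _) hF0
  have b3 := mul_le_mul (hG t ht) (sq_le (abs_max_zero_le_one (c := -Real.cos x)
    (by simpa using Real.abs_cos_le_one x))) (abs_nonneg _) hG0
  have b4 := mul_le_mul (hQ t ht) (sq_le (Real.abs_cos_le_one x)) (abs_nonneg _) hQ0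
  rw [← abs_mul] at b1 b2 b3 b4
  have key : field p q f g t x = (p t)⁻¹ * Real.sin x ^ 2 + f t * max (Real.cos x) 0 ^ 2
      + g t * max (-Real.cos x) 0 ^ 2 - q t * Real.cos x ^ 2 := by
    simp only [field]; ring
  rw [key]
  refine (abs_sub _ _).trans ?_
  have := abs_add_three ((p t)⁻¹ * Real.sin x ^ 2) (f t * max (Real.cos x) 0 ^ 2)
    (g t * max (-Real.cos x) 0 ^ 2)
  linarith

/-- Replacing u by -u exchanges the two weights. This transfers results about one sign of u to the
other. -/
theorem field_add_pi (t x : ℝ) : field p q f g t (x + Real.pi) = field p q g f t x := by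
  simp only [field, Real.sin_add_pi, Real.cos_add_pi, neg_neg]; ring

theorem field_add_int_mul_two_pi (t x : ℝ) (i : ℤ) :
    field p q f g t (x + i * (2 * Real.pi)) = field p q f g t x := by
  simp only [field, Real.sin_add_int_mul_two_pi, Real.cos_add_int_mul_two_pi]

theorem field_of_cos_eq_zero {t x : ℝ} (hx : Real.cos x = 0) : field p q f g t x = (p t)⁻¹ := by
  have : Real.sin x ^ 2 = 1 := by nlinarith [Real.sin_sq_add_cos_sq x]
  simp [field, hx, this]

/-! ### Comparison -/

/-- The difference cannot cross the exponential, because `hK` makes the exponential steeper than the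
difference at any contact. Positive c with K = L + 1 yields weak comparison; negative c with K = -L
- 1 yields strict comparison. -/
theorem le_barrier {φ ψ φ' ψ' : ℝ → ℝ} {L c : ℝ}
    (hφ : ContinuousOn φ (Icc α β)) (hψ : ContinuousOn ψ (Icc α β))
    (hφ' : ∀ t ∈ Ico α β, HasDerivWithinAt φ (φ' t) (Ici t) t)
    (hψ' : ∀ t ∈ Ico α β, HasDerivWithinAt ψ (ψ' t) (Ici t) t)
    (hL : ∀ t ∈ Ico α β, φ' t - ψ' t ≤ L * |φ t - ψ t|)
    (K : ℝ) (hK : L * |c| < K * c) (h0 : φ α - ψ α ≤ c) :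
    ∀ t ∈ Icc α β, φ t - ψ t ≤ c * Real.exp (K * (t - α)) := by
  have hB (x : ℝ) : HasDerivAt (fun t => c * Real.exp (K * (t - α)))
      (c * (Real.exp (K * (x - α)) * K)) x := by
    have := (((hasDerivAt_id x).sub_const α).const_mul K).exp.const_mul c
    simpa using this
  refine image_le_of_deriv_right_lt_deriv_boundary' (hφ.sub hψ)
    (fun t ht => (hφ' t ht).sub (hψ' t ht)) (B := fun t => c * Real.exp (K * (t - α)))
    (B' := fun x => c * (Real.exp (K * (x - α)) * K)) (by simpa using h0)
    (fun x _ => (hB x).continuousAt.continuousWithinAt)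
    (fun x _ => (hB x).hasDerivWithinAt) ?_
  intro t ht heq
  refine (hL t ht).trans_lt ?_
  have heq' : φ t - ψ t = c * Real.exp (K * (t - α)) := heq
  rw [heq', abs_mul, abs_of_pos (Real.exp_pos _)]
  have := mul_lt_mul_of_pos_right hK (Real.exp_pos (K * (t - α)))
  linarith

theorem le_of_deriv_right_sub_le {φ ψ φ' ψ' : ℝ → ℝ} {L : ℝ}
    (hφ : ContinuousOn φ (Icc α β)) (hψ : ContinuousOn ψ (Icc α β))
    (hφ' : ∀ t ∈ Ico α β, HasDerivWithinAt φ (φ' t) (Ici t) t)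
    (hψ' : ∀ t ∈ Ico α β, HasDerivWithinAt ψ (ψ' t) (Ici t) t)
    (hL : ∀ t ∈ Ico α β, φ' t - ψ' t ≤ L * |φ t - ψ t|)
    (h0 : φ α ≤ ψ α) : ∀ t ∈ Icc α β, φ t ≤ ψ t := by
  intro t ht
  by_contra! hlt
  set E := Real.exp ((L + 1) * (t - α))
  have hE : 0 < E := Real.exp_pos _
  -- With this c the barrier at time t is half of the supposed gap.
  have hc : 0 < (φ t - ψ t) / (2 * E) := div_pos (by linarith) (by positivity)
  have := le_barrier hφ hψ hφ' hψ' hL (L + 1) (c := (φ t - ψ t) / (2 * E))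
    (by rw [abs_of_pos hc]; linarith) (by linarith) t ht
  have h2 : (φ t - ψ t) / (2 * E) * E = (φ t - ψ t) / 2 := by field_simp
  linarith

theorem lt_of_deriv_right_sub_le {φ ψ φ' ψ' : ℝ → ℝ} {L : ℝ}
    (hφ : ContinuousOn φ (Icc α β)) (hψ : ContinuousOn ψ (Icc α β))
    (hφ' : ∀ t ∈ Ico α β, HasDerivWithinAt φ (φ' t) (Ici t) t)
    (hψ' : ∀ t ∈ Ico α β, HasDerivWithinAt ψ (ψ' t) (Ici t) t)
    (hL : ∀ t ∈ Ico α β, φ' t - ψ' t ≤ L * |φ t - ψ t|)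
    (h0 : φ α < ψ α) : ∀ t ∈ Icc α β, φ t < ψ t := by
  intro t ht
  have hc : φ α - ψ α < 0 := by linarith
  have := le_barrier hφ hψ hφ' hψ' hL (-L - 1) (c := φ α - ψ α)
    (by rw [abs_of_neg hc]; linarith) le_rfl t ht
  have h2 := mul_neg_of_neg_of_pos hc (Real.exp_pos ((-L - 1) * (t - α)))
  linarith

theorem _root_.HasDerivWithinAt.Ici_of_Icc {φ : ℝ → ℝ} {d t : ℝ}
    (h : HasDerivWithinAt φ d (Icc α β) t) (ht : t ∈ Ico α β) : HasDerivWithinAt φ d (Ici t) t :=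
  h.mono_of_mem_nhdsWithin (Icc_mem_nhdsGE_of_mem ht)

namespace IsAngle

variable {θ φ ψ : ℝ → ℝ}

theorem continuousOn (h : IsAngle p q f g α β θ) : ContinuousOn θ (Icc α β) :=
  fun t ht => (h t ht).continuousWithinAt

theorem mono (h : IsAngle p q f g α β θ) {α' β' : ℝ} (hα : α ≤ α') (hβ : β' ≤ β) :
    IsAngle p q f g α' β' θ := by
  have hs : Icc α' β' ⊆ Icc α β := Icc_subset_Icc hα hβ
  exact fun t ht => (h t (hs ht)).mono hs

theorem add_pi (h : IsAngle p q f g α β θ) : IsAngle p q g f α β (fun t => θ t + Real.pi) :=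
  fun t ht => by
    rw [field_add_pi]
    exact (h t ht).add_const _

theorem add_int_mul_two_pi (h : IsAngle p q f g α β θ) (i : ℤ) :
    IsAngle p q f g α β (fun t => θ t + i * (2 * Real.pi)) :=
  fun t ht => by
    rw [field_add_int_mul_two_pi]
    exact (h t ht).add_const _

theorem subsolution_le (hc : Coeffs p q f g α β) (h : IsAngle p q f g α β θ) {φ' : ℝ → ℝ}
    (hφ : ContinuousOn φ (Icc α β)) (hφ' : ∀ t ∈ Ico α β, HasDerivWithinAt φ (φ' t) (Ici t) t)
    (hle : ∀ t ∈ Ico α β, φ' t ≤ field p q f g t (φ t)) (h0 : φ α ≤ θ α) :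
    ∀ t ∈ Icc α β, φ t ≤ θ t := by
  obtain ⟨L, -, hL⟩ := exists_lipschitz_field hc
  refine le_of_deriv_right_sub_le hφ h.continuousOn hφ'
    (fun t ht => (h t (Ico_subset_Icc_self ht)).Ici_of_Icc ht) (L := L) (fun t ht => ?_) h0
  have := hL t (Ico_subset_Icc_self ht) (φ t) (θ t)
  linarith [le_abs_self (field p q f g t (φ t) - field p q f g t (θ t)), hle t ht]

theorem le_supersolution (hc : Coeffs p q f g α β) (h : IsAngle p q f g α β θ) {φ' : ℝ → ℝ}
    (hφ : ContinuousOn φ (Icc α β)) (hφ' : ∀ t ∈ Ico α β, HasDerivWithinAt φ (φ' t) (Ici t) t)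
    (hle : ∀ t ∈ Ico α β, field p q f g t (φ t) ≤ φ' t) (h0 : θ α ≤ φ α) :
    ∀ t ∈ Icc α β, θ t ≤ φ t := by
  obtain ⟨L, -, hL⟩ := exists_lipschitz_field hc
  refine le_of_deriv_right_sub_le h.continuousOn hφ
    (fun t ht => (h t (Ico_subset_Icc_self ht)).Ici_of_Icc ht) hφ' (L := L) (fun t ht => ?_) h0
  have := hL t (Ico_subset_Icc_self ht) (θ t) (φ t)
  linarith [le_abs_self (field p q f g t (θ t) - field p q f g t (φ t)), hle t ht]

theorem lt_supersolution (hc : Coeffs p q f g α β) (h : IsAngle p q f g α β θ) {φ' : ℝ → ℝ}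
    (hφ : ContinuousOn φ (Icc α β)) (hφ' : ∀ t ∈ Ico α β, HasDerivWithinAt φ (φ' t) (Ici t) t)
    (hle : ∀ t ∈ Ico α β, field p q f g t (φ t) ≤ φ' t) (h0 : θ α < φ α) :
    ∀ t ∈ Icc α β, θ t < φ t := by
  obtain ⟨L, -, hL⟩ := exists_lipschitz_field hc
  refine lt_of_deriv_right_sub_le h.continuousOn hφ
    (fun t ht => (h t (Ico_subset_Icc_self ht)).Ici_of_Icc ht) hφ' (L := L) (fun t ht => ?_) h0
  have := hL t (Ico_subset_Icc_self ht) (θ t) (φ t)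
  linarith [le_abs_self (field p q f g t (θ t) - field p q f g t (φ t)), hle t ht]

theorem lt (hc : Coeffs p q f g α β) (h : IsAngle p q f g α β θ) (hφ : IsAngle p q f g α β φ)
    (h0 : θ α < φ α) : ∀ t ∈ Icc α β, θ t < φ t :=
  h.lt_supersolution hc hφ.continuousOn
    (fun t ht => (hφ t (Ico_subset_Icc_self ht)).Ici_of_Icc ht) (fun _ _ => le_rfl) h0

theorem eqOn (hc : Coeffs p q f g α β) (h : IsAngle p q f g α β θ) (hφ : IsAngle p q f g α β φ)
    (h0 : θ α = φ α) : ∀ t ∈ Icc α β, θ t = φ t := fun t ht =>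
  le_antisymm
    (h.le_supersolution hc hφ.continuousOn
      (fun t ht => (hφ t (Ico_subset_Icc_self ht)).Ici_of_Icc ht) (fun _ _ => le_rfl) h0.le t ht)
    (hφ.le_supersolution hc h.continuousOn
      (fun t ht => (h t (Ico_subset_Icc_self ht)).Ici_of_Icc ht) (fun _ _ => le_rfl) h0.ge t ht)

/-- The zeros of `u` are crossed by the angle in the upward direction only. -/
theorem level_lt (hc : Coeffs p q f g α β) (h : IsAngle p q f g α β θ) {x : ℝ}
    (hx : Real.cos x = 0) (h0 : x ≤ θ α) {t : ℝ} (ht : t ∈ Ioc α β) : x < θ t := by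
  obtain ⟨L, hL0, hL⟩ := exists_lipschitz_field hc
  obtain ⟨P, hP0, hP⟩ := exists_abs_le_of_continuousOn hc.p_cont
  have hαβ : α ≤ β := ht.1.le.trans ht.2
  -- D is chosen so that D⁻¹ + L D⁻¹ (β - α) = (P + 1)⁻¹ ≤ 1/p. The line of slope D⁻¹ issuing from x
  -- is then a subsolution: the field is 1/p at level x and loses at most L D⁻¹ (β - α) along the
  -- line.
  set D := (P + 1) * (1 + L * (β - α))
  have hD : 0 < D := by
    have : 0 ≤ L * (β - α) := mul_nonneg hL0 (by linarith)
    positivity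
  have hlin (s : ℝ) : HasDerivAt (fun s => x + D⁻¹ * (s - α)) D⁻¹ s := by
    simpa using (((hasDerivAt_id s).sub_const α).const_mul D⁻¹).const_add x
  have hsub := h.subsolution_le hc (φ := fun s => x + D⁻¹ * (s - α)) (φ' := fun _ => D⁻¹)
    (fun s _ => (hlin s).continuousAt.continuousWithinAt) (fun s _ => (hlin s).hasDerivWithinAt)
    (fun s hs => ?_) (by simpa using h0) t (Ioc_subset_Icc_self ht)
  · have : 0 < D⁻¹ * (t - α) := mul_pos (inv_pos.2 hD) (by linarith [ht.1])
    linarith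
  · have hs' := Ico_subset_Icc_self hs
    have h1 := hL s hs' (x + D⁻¹ * (s - α)) x
    rw [field_of_cos_eq_zero hx, add_sub_cancel_left,
      abs_of_nonneg (mul_nonneg (inv_nonneg.2 hD.le) (by linarith [hs.1]))] at h1
    have h2 : (P + 1)⁻¹ ≤ (p s)⁻¹ := by
      have := hc.p_pos s hs'
      gcongr
      linarith [le_abs_self (p s), hP s hs']
    have h3 : L * (D⁻¹ * (s - α)) ≤ L * (D⁻¹ * (β - α)) := by
      have := hs.2.le
      have := inv_nonneg.2 hD.le
      gcongr
    have h4 : D⁻¹ + L * (D⁻¹ * (β - α)) = (P + 1)⁻¹ := by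
      have h5 : D⁻¹ * D = 1 := inv_mul_cancel₀ hD.ne'
      have h6 : (P + 1) ≠ 0 := by positivity
      field_simp
      simp only [D]
      ring
    have h7 := (abs_le.1 h1).1
    linarith

end IsAngle

/-! ### Existence and continuous dependence -/

theorem exists_isAngle (hαβ : α ≤ β) (hc : Coeffs p q f g α β) (x : ℝ) :
    ∃ θ, IsAngle p q f g α β θ ∧ θ α = x := by
  obtain ⟨L, hL0, hL⟩ := exists_lipschitz_field hc
  obtain ⟨M, hM0, hM⟩ := exists_bound_field hc
  lift L to NNReal using hL0
  lift M to NNReal using hM0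
  -- The field is bounded by M for all angles, so the radius M(β - α) lets a single application
  -- cover the whole interval.
  have hPL : IsPicardLindelof (field p q f g) (⟨α, left_mem_Icc.2 hαβ⟩ : Icc α β) x
      (M * ⟨β - α, sub_nonneg.2 hαβ⟩) 0 M L := by
    refine ⟨fun t ht => ?_, fun y _ => continuousOn_field hc continuousOn_const,
      fun t ht y _ => hM t ht y, ?_⟩
    · refine LipschitzWith.lipschitzOnWith (LipschitzWith.of_dist_le_mul fun y z => ?_)
      simpa [Real.dist_eq] using hL t ht y z
    · have : (0:ℝ) ≤ β - α := by linarith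
      simp [this]
      rfl
  obtain ⟨θ, h0, hθ⟩ := hPL.exists_eq_forall_mem_Icc_hasDerivWithinAt₀
  exact ⟨θ, hθ, h0⟩

/-- Gronwall: the fields for b and b' differ by at most N|b' - b|, with N a bound for |n|. -/
theorem exists_angle_continuous (hαβ : α ≤ β) {n : ℝ → ℝ} (hc : Coeffs p q f n α β) (x : ℝ) :
    ∃ Θ : ℝ → ℝ, Continuous Θ ∧ ∀ b, ∃ θ, IsAngle p q f (fun t => b * n t) α β θ ∧
      θ α = x ∧ θ β = Θ b := by
  have hcb (b : ℝ) : Coeffs p q f (fun t => b * n t) α β :=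
    ⟨hc.p_cont, hc.q_cont, hc.f_cont, continuousOn_const.mul hc.g_cont, hc.p_pos⟩
  choose θ hθ hθ0 using fun b => exists_isAngle hαβ (hcb b) x
  refine ⟨fun b => θ b β, ?_, fun b => ⟨θ b, hθ b, hθ0 b, rfl⟩⟩
  rw [continuous_iff_continuousAt]
  intro b
  obtain ⟨L, hL0, hL⟩ := exists_lipschitz_field (hcb b)
  obtain ⟨N, hN0, hN⟩ := exists_abs_le_of_continuousOn hc.g_cont
  lift L to NNReal using hL0
  have key (b' : ℝ) : dist (θ b' β) (θ b β) ≤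
      gronwallBound 0 L (|b' - b| * N) (β - α) := by
    have := dist_le_of_approx_trajectories_ODE_of_mem (v := field p q f (fun t => b * n t))
      (K := L) (s := fun _ => univ) (f := θ b') (g := θ b) (a := α) (b := β)
      (f' := fun t => field p q f (fun t => b' * n t) t (θ b' t))
      (g' := fun t => field p q f (fun t => b * n t) t (θ b t))
      (εf := |b' - b| * N) (εg := 0) (δ := 0)
      (fun t ht => (LipschitzWith.of_dist_le_mul fun y z => by
        simpa [Real.dist_eq] using hL t (Ico_subset_Icc_self ht) y z).lipschitzOnWith)
      (hθ b').continuousOn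
      (fun t ht => (hθ b' t (Ico_subset_Icc_self ht)).Ici_of_Icc ht)
      (fun t ht => ?_) (fun _ _ => trivial) (hθ b).continuousOn
      (fun t ht => (hθ b t (Ico_subset_Icc_self ht)).Ici_of_Icc ht)
      (fun t _ => by simp) (fun _ _ => trivial) (by simp [hθ0]) β (right_mem_Icc.2 hαβ)
    · simpa using this
    · have : field p q f (fun t => b' * n t) t (θ b' t) - field p q f (fun t => b * n t) t (θ b' t)
          = (b' - b) * (n t * max (-Real.cos (θ b' t)) 0 ^ 2) := by
        simp only [field]; ring
      rw [Real.dist_eq, this, abs_mul, abs_mul, abs_pow]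
      have h1 := hN t (Ico_subset_Icc_self ht)
      have h2 : |max (-Real.cos (θ b' t)) 0| ^ 2 ≤ 1 := pow_le_one₀ (abs_nonneg _)
        (abs_max_zero_le_one (by simpa using Real.abs_cos_le_one _))
      have h3 := mul_le_mul h1 h2 (by positivity) hN0
      rw [mul_one] at h3
      gcongr
  rw [ContinuousAt, tendsto_iff_dist_tendsto_zero]
  refine squeeze_zero (fun _ => dist_nonneg) key ?_
  have h1 : Continuous fun b' : ℝ =>
      gronwallBound 0 L (|b' - b| * N) (β - α) :=
    (gronwallBound_continuous_ε 0 _ (β - α)).comp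
      (((continuous_id.sub continuous_const).abs).mul continuous_const)
  have h2 := h1.tendsto b
  simpa [gronwallBound_ε0_δ0] using h2

end Fucik

namespace Fucik
open Set Filter Topology

variable {p q f g : ℝ → ℝ} {α β : ℝ}

/-! ### Solutions and Prüfer angles -/

/-- The angle equation makes the polar system consistent; the radius then solves R' = ρR and is an
explicit exponential. -/
theorem IsAngle.exists_polar {θ : ℝ → ℝ} (hαβ : α ≤ β) (hc : Coeffs p q f g α β)
    (h : IsAngle p q f g α β θ) {R₀ : ℝ} (hR₀ : 0 < R₀) :
    ∃ R : ℝ → ℝ, (∀ t, 0 < R t) ∧ R α = R₀ ∧ ∀ t ∈ Icc α β,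
      HasDerivWithinAt (fun s => R s * Real.cos (θ s)) (-(R t * Real.sin (θ t)) / p t)
        (Icc α β) t ∧
      HasDerivWithinAt (fun s => -(R s * Real.sin (θ s)))
        (q t * (R t * Real.cos (θ t)) - (f t * max (R t * Real.cos (θ t)) 0
          - g t * max (-(R t * Real.cos (θ t))) 0)) (Icc α β) t := by
  set ρ : ℝ → ℝ := fun t => Real.cos (θ t) * (-Real.sin (θ t) / p t) - Real.sin (θ t) *
    (q t * Real.cos (θ t) - (f t * max (Real.cos (θ t)) 0 - g t * max (-Real.cos (θ t)) 0))
    with hρ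
  have hs := Real.continuous_sin.comp_continuousOn h.continuousOn
  have hcs := Real.continuous_cos.comp_continuousOn h.continuousOn
  have hc' : ContinuousOn (fun t => max (Real.cos (θ t)) 0) (Icc α β) := hcs.sup continuousOn_const
  have hc'' : ContinuousOn (fun t => max (-Real.cos (θ t)) 0) (Icc α β) :=
    hcs.neg.sup continuousOn_const
  have hρc : ContinuousOn ρ (Icc α β) :=
    (hcs.mul (hs.neg.div hc.p_cont fun t ht => (hc.p_pos t ht).ne')).sub
      (hs.mul ((hc.q_cont.mul hcs).sub ((hc.f_cont.mul hc').sub (hc.g_cont.mul hc''))))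
  -- The continuous extension to ℝ makes the integral differentiable at the end points too.
  set ρ' : ℝ → ℝ := IccExtend hαβ ((Icc α β).domRestrict ρ)
  have hρ' : Continuous ρ' := (continuousOn_iff_continuous_domRestrict.1 hρc).Icc_extend'
  set R : ℝ → ℝ := fun t => R₀ * Real.exp (∫ s in α..t, ρ' s)
  have hRpos (t : ℝ) : 0 < R t := mul_pos hR₀ (Real.exp_pos _)
  have hR (t : ℝ) (ht : t ∈ Icc α β) : HasDerivAt R (R t * ρ t) t := by
    have h1 := (hρ'.integral_hasStrictDerivAt α t).hasDerivAt.exp.const_mul R₀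
    have h2 : ρ' t = ρ t := IccExtend_of_mem hαβ _ ht
    rw [h2] at h1
    rwa [← mul_assoc] at h1
  refine ⟨R, hRpos, by simp [R], fun t ht => ?_⟩
  have hRt := (hRpos t).le
  have hm1 : max (R t * Real.cos (θ t)) 0 = R t * max (Real.cos (θ t)) 0 := by
    rw [mul_max_of_nonneg _ _ hRt, mul_zero]
  have hm2 : max (-(R t * Real.cos (θ t))) 0 = R t * max (-Real.cos (θ t)) 0 := by
    rw [mul_max_of_nonneg _ _ hRt, mul_zero, mul_neg]
  have hp := (hc.p_pos t ht).ne'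
  have hsc := Real.sin_sq_add_cos_sq (θ t)
  have hm3 : Real.cos (θ t) * max (Real.cos (θ t)) 0 = max (Real.cos (θ t)) 0 ^ 2 := by
    rcases le_total 0 (Real.cos (θ t)) with h0 | h0
    · rw [max_eq_left h0, sq]
    · rw [max_eq_right h0]; simp
  have hm4 : Real.cos (θ t) * max (-Real.cos (θ t)) 0 = -max (-Real.cos (θ t)) 0 ^ 2 := by
    rcases le_total 0 (Real.cos (θ t)) with h0 | h0
    · rw [max_eq_right (by linarith)]; simp
    · rw [max_eq_left (by linarith)]; ring
  have d1 := (hR t ht).hasDerivWithinAt.fun_mul (h t ht).cos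
  have d2 := ((hR t ht).hasDerivWithinAt.fun_mul (h t ht).sin).fun_neg
  constructor
  · refine d1.congr_deriv ?_
    simp only [hρ, field]
    linear_combination R t * Real.sin (θ t) * f t * hm3 - R t * Real.sin (θ t) * g t * hm4
      - (R t * Real.sin (θ t) / p t) * hsc
  · refine d2.congr_deriv ?_
    rw [hm1, hm2]
    simp only [hρ, field]
    linear_combination (R t * (q t * Real.cos (θ t) - (f t * max (Real.cos (θ t)) 0
      - g t * max (-Real.cos (θ t)) 0))) * hsc - R t * Real.cos (θ t) * g t * hm4
      + R t * Real.cos (θ t) * f t * hm3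

/-- The right-hand side is Lipschitz in (u, w), since positive parts are 1-Lipschitz. This excludes
u(T₁) = 0 for a nontrivial solution and identifies a solution with its polar form. -/
theorem system_unique (hc : Coeffs p q f g α β) {u w u₁ w₁ : ℝ → ℝ}
    (hu : ContinuousOn u (Icc α β)) (hw : ContinuousOn w (Icc α β))
    (hu₁ : ContinuousOn u₁ (Icc α β)) (hw₁ : ContinuousOn w₁ (Icc α β))
    (du : ∀ t ∈ Ico α β, HasDerivWithinAt u (w t / p t) (Ici t) t)
    (dw : ∀ t ∈ Ico α β, HasDerivWithinAt w
      (q t * u t - (f t * max (u t) 0 - g t * max (-u t) 0)) (Ici t) t)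
    (du₁ : ∀ t ∈ Ico α β, HasDerivWithinAt u₁ (w₁ t / p t) (Ici t) t)
    (dw₁ : ∀ t ∈ Ico α β, HasDerivWithinAt w₁
      (q t * u₁ t - (f t * max (u₁ t) 0 - g t * max (-u₁ t) 0)) (Ici t) t)
    (hu0 : u α = u₁ α) (hw0 : w α = w₁ α) :
    ∀ t ∈ Icc α β, u t = u₁ t ∧ w t = w₁ t := by
  obtain ⟨P, hP0, hP⟩ := exists_abs_le_of_continuousOn
    (φ := fun t => (p t)⁻¹) (hc.p_cont.inv₀ fun t ht => (hc.p_pos t ht).ne')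
  obtain ⟨Q, hQ0, hQ⟩ := exists_abs_le_of_continuousOn hc.q_cont
  obtain ⟨F, hF0, hF⟩ := exists_abs_le_of_continuousOn hc.f_cont
  obtain ⟨G, hG0, hG⟩ := exists_abs_le_of_continuousOn hc.g_cont
  set V : ℝ → ℝ × ℝ → ℝ × ℝ := fun t z =>
    (z.2 / p t, q t * z.1 - (f t * max z.1 0 - g t * max (-z.1) 0))
  have hV (t : ℝ) (ht : t ∈ Icc α β) :
      LipschitzWith ⟨P + (Q + (F + G)), by positivity⟩ (V t) := by
    refine LipschitzWith.of_dist_le_mul fun y z => ?_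
    change _ ≤ (P + (Q + (F + G))) * _
    have e1 : |y.1 - z.1| ≤ dist y z := by rw [← Real.dist_eq, Prod.dist_eq]; exact le_max_left _ _
    have e2 : |y.2 - z.2| ≤ dist y z := by rw [← Real.dist_eq, Prod.dist_eq]; exact le_max_right _ _
    have hd : 0 ≤ dist y z := dist_nonneg
    have e3 : |max y.1 0 - max z.1 0| ≤ dist y z := (abs_max_sub_max_le_abs _ _ _).trans e1
    have e4 : |max (-y.1) 0 - max (-z.1) 0| ≤ dist y z :=
      (abs_max_sub_max_le_abs _ _ _).trans (by rwa [neg_sub_neg, abs_sub_comm])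
    have b1 := mul_le_mul (hP t ht) e2 (abs_nonneg _) hP0
    have b2 := mul_le_mul (hQ t ht) e1 (abs_nonneg _) hQ0
    have b3 := mul_le_mul (hF t ht) e3 (abs_nonneg _) hF0
    have b4 := mul_le_mul (hG t ht) e4 (abs_nonneg _) hG0
    have n1 := mul_nonneg hP0 hd
    have n2 := mul_nonneg hQ0 hd
    have n3 := mul_nonneg hF0 hd
    have n4 := mul_nonneg hG0 hd
    rw [← abs_mul] at b1 b2 b3 b4
    rw [Prod.dist_eq]
    refine max_le ?_ ?_
    · have : (V t y).1 - (V t z).1 = (p t)⁻¹ * (y.2 - z.2) := by simp only [V]; ring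
      rw [Real.dist_eq, this]
      linarith
    · have : (V t y).2 - (V t z).2 = q t * (y.1 - z.1) - f t * (max y.1 0 - max z.1 0)
          + g t * (max (-y.1) 0 - max (-z.1) 0) := by simp only [V]; ring
      rw [Real.dist_eq, this]
      have t1 := abs_add_le (q t * (y.1 - z.1) - f t * (max y.1 0 - max z.1 0))
        (g t * (max (-y.1) 0 - max (-z.1) 0))
      have t2 := abs_sub (q t * (y.1 - z.1)) (f t * (max y.1 0 - max z.1 0))
      linarith
  have := ODE_solution_unique_of_mem_Icc_right (v := V) (s := fun _ => univ)
    (f := fun t => (u t, w t)) (g := fun t => (u₁ t, w₁ t)) (a := α) (b := β)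
    (fun t ht => (hV t (Ico_subset_Icc_self ht)).lipschitzOnWith)
    (hu.prodMk hw) (fun t ht => (du t ht).prodMk (dw t ht)) (fun _ _ => trivial)
    (hu₁.prodMk hw₁) (fun t ht => (du₁ t ht).prodMk (dw₁ t ht)) (fun _ _ => trivial)
    (by simp [hu0, hw0])
  intro t ht
  exact Prod.mk.inj (this ht)

/-- Upward crossing makes θ injective on the zeros and confines their levels between θ(α) and θ(β).
The k levels jπ - iπ - π/2, i < k, are all attained by the intermediate value theorem. -/
theorem IsAngle.encard_zeros {θ : ℝ → ℝ} (hαβ : α < β) (hc : Coeffs p q f g α β)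
    (h : IsAngle p q f g α β θ) {j : ℤ} {k : ℕ} (h0 : θ α = j * Real.pi - k * Real.pi)
    (h1 : θ β = j * Real.pi) :
    {t | t ∈ Ioo α β ∧ Real.cos (θ t) = 0}.encard = (k : ℕ∞) := by
  have hpi := Real.pi_pos
  set Z := {t | t ∈ Ioo α β ∧ Real.cos (θ t) = 0}
  have hinj : InjOn θ Z := by
    have key : ∀ s ∈ Z, ∀ t ∈ Z, s < t → θ s < θ t := fun s hs t ht hst =>
      (h.mono hs.1.1.le le_rfl).level_lt (hc.mono hs.1.1.le le_rfl) hs.2 le_rfl ⟨hst, ht.1.2.le⟩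
    intro s hs t ht hst
    rcases lt_trichotomy s t with hlt | rfl | hlt
    · exact absurd hst (key s hs t ht hlt).ne
    · rfl
    · exact absurd hst (key t ht s hs hlt).ne'
  set L : ℕ → ℝ := fun i => j * Real.pi - i * Real.pi - Real.pi / 2
  have hLinj : Function.Injective L := by
    intro i i' hii
    have : (i : ℝ) * Real.pi = i' * Real.pi := by simp only [L] at hii; linarith
    exact_mod_cast mul_right_cancel₀ hpi.ne' this
  have himg : θ '' Z = L '' (Finset.range k : Set ℕ) := by
    ext x
    constructor
    · rintro ⟨t, ⟨ht, htc⟩, rfl⟩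
      obtain ⟨i, hi⟩ := Real.cos_eq_zero_iff.1 htc
      have hlt : θ t < j * Real.pi := by
        by_contra! hle
        have hβ : θ t < θ β := (h.mono ht.1.le le_rfl).level_lt (hc.mono ht.1.le le_rfl) htc le_rfl
          ⟨ht.2, le_rfl⟩
        linarith
      have hgt : (j : ℝ) * Real.pi - k * Real.pi < θ t := by
        rw [← h0]
        by_contra! hle
        exact lt_irrefl _ (h.level_lt hc htc hle ⟨ht.1, ht.2.le⟩)
      rw [hi] at hlt hgt
      have hlt' : (i : ℝ) + 1 / 2 < j := by
        have : ((i : ℝ) + 1 / 2) * Real.pi < j * Real.pi := by linarith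
        exact lt_of_mul_lt_mul_right this hpi.le
      have hgt' : (j : ℝ) - k < i + 1 / 2 := by
        have : ((j : ℝ) - k) * Real.pi < (i + 1 / 2) * Real.pi := by linarith
        exact lt_of_mul_lt_mul_right this hpi.le
      have h2 : i < j := by
        have : (i : ℝ) < j := by linarith
        exact_mod_cast this
      have h3 : j - k ≤ i := by
        by_contra! hlt
        have : i + 1 ≤ j - k := hlt
        have : (i : ℝ) + 1 ≤ j - k := by exact_mod_cast this
        linarith
      refine ⟨(j - 1 - i).toNat, by simp; omega, ?_⟩
      have h4 : (((j - 1 - i).toNat : ℤ) : ℝ) = ((j - 1 - i : ℤ) : ℝ) := by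
        rw [Int.toNat_of_nonneg (by omega)]
      have h5 : (((j - 1 - i).toNat : ℕ) : ℝ) = j - 1 - i := by
        rw [← Int.cast_natCast, h4]; push_cast; ring
      simp only [L, h5, hi]
      ring
    · rintro ⟨i, hi, rfl⟩
      have hik : (i : ℝ) + 1 ≤ k := by
        have : i < k := by simpa using hi
        exact_mod_cast this
      have hm : ((i : ℝ) + 1) * Real.pi ≤ k * Real.pi := by gcongr
      have hi0 : 0 ≤ (i : ℝ) * Real.pi := by positivity
      have hmem : L i ∈ Ioo (θ α) (θ β) := by
        rw [h0, h1]
        constructor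
        · simp only [L]; linarith
        · simp only [L]; linarith
      obtain ⟨t, ht, hti⟩ := intermediate_value_Ioo hαβ.le h.continuousOn hmem
      refine ⟨t, ⟨ht, ?_⟩, hti⟩
      rw [hti, Real.cos_eq_zero_iff]
      refine ⟨j - i - 1, ?_⟩
      simp only [L]
      push_cast
      ring
  rw [← hinj.encard_image, himg, hLinj.encard_image, Set.encard_coe_eq_coe_finsetCard,
    Finset.card_range]

/-- The angle reached at the right end point by the solutions of the given final sign. -/
noncomputable def endAngle : Sgn → ℝ
  | Sgn.pos => 0
  | Sgn.neg => Real.pi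

theorem exists_endAngle_eq (σ : Sgn) : ∃ j : ℤ, endAngle σ = j * Real.pi := by
  cases σ
  · exact ⟨0, by simp [endAngle]⟩
  · exact ⟨1, by simp [endAngle]⟩

theorem sin_endAngle (σ : Sgn) : Real.sin (endAngle σ) = 0 := by
  cases σ <;> simp [endAngle]

theorem hasSign_mul_cos_endAngle (σ : Sgn) {r : ℝ} (hr : 0 < r) :
    HasSign σ (r * Real.cos (endAngle σ)) := by
  cases σ <;> simp [endAngle, HasSign, hr]

variable {T₁ T₂ a b : ℝ} {m n : ℝ → ℝ} {k : ℕ} {σ : Sgn}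

theorem mem_curve_of_isAngle (hT : T₁ < T₂) (hc : Coeffs p q m n T₁ T₂) {θ : ℝ → ℝ}
    (h : IsAngle p q (fun t => a * m t) (fun t => b * n t) T₁ T₂ θ)
    (h0 : θ T₁ = endAngle σ - k * Real.pi) (h1 : θ T₂ = endAngle σ) :
    (a, b) ∈ curve T₁ T₂ p q m n σ k := by
  have hab := hc.of_smul a b
  obtain ⟨R, hR, -, hd⟩ := h.exists_polar hT.le hab one_pos
  obtain ⟨j, hj⟩ := exists_endAngle_eq σ
  have hsin0 : Real.sin (θ T₁) = 0 := by
    rw [h0, hj]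
    have : (j : ℝ) * Real.pi - k * Real.pi = ((j - k : ℤ) : ℝ) * Real.pi := by push_cast; ring
    rw [this, Real.sin_int_mul_pi]
  refine ⟨fun s => R s * Real.cos (θ s), ⟨fun t => -(R t * Real.sin (θ t)) / p t,
    fun t ht => (hd t ht).1, ?_, ?_, by simp [hsin0], by simp [h1, sin_endAngle]⟩, ?_, ?_⟩
  · have hw : ContinuousOn (fun s => -(R s * Real.sin (θ s))) (Icc T₁ T₂) :=
      fun t ht => (hd t ht).2.continuousWithinAt
    exact hw.div hc.p_cont fun t ht => (hc.p_pos t ht).ne'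
  · intro t ht
    have hmem := Icc_mem_nhds ht.1 ht.2
    refine ⟨_, ((hd t (Ioo_subset_Icc_self ht)).2.hasDerivAt hmem).congr_of_eventuallyEq ?_, ?_⟩
    · filter_upwards [hmem] with s hs
      exact mul_div_cancel₀ _ (hc.p_pos s hs).ne'
    · ring
  · have : {t | t ∈ Ioo T₁ T₂ ∧ R t * Real.cos (θ t) = 0}
        = {t | t ∈ Ioo T₁ T₂ ∧ Real.cos (θ t) = 0} := by
      ext t
      simp [(hR t).ne']
    rw [this]
    exact h.encard_zeros hT hab (j := j) (by rw [h0, hj]) (by rw [h1, hj])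
  · simp only [h1]
    exact hasSign_mul_cos_endAngle σ (hR _)

/-- Start the angle at 0 or π according to the sign of u(T₁). Uniqueness identifies u with the polar
form, and the zero count fixes the rise; a shift by a multiple of 2π normalizes the end value. -/
theorem exists_isAngle_of_mem_curve (hT : T₁ < T₂) (hc : Coeffs p q m n T₁ T₂)
    (hmem : (a, b) ∈ curve T₁ T₂ p q m n σ k) :
    ∃ θ, IsAngle p q (fun t => a * m t) (fun t => b * n t) T₁ T₂ θ ∧
      θ T₁ = endAngle σ - k * Real.pi ∧ θ T₂ = endAngle σ := by
  have hpi := Real.pi_pos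
  have hab := hc.of_smul a b
  obtain ⟨u, ⟨v, huv, hv, hw, hv1, hv2⟩, hcard, hsgn⟩ := hmem
  have hl : T₁ ∈ Icc T₁ T₂ := left_mem_Icc.2 hT.le
  have hr : T₂ ∈ Icc T₁ T₂ := right_mem_Icc.2 hT.le
  have hu : ContinuousOn u (Icc T₁ T₂) := fun t ht => (huv t ht).continuousWithinAt
  set w : ℝ → ℝ := fun s => p s * v s
  have hwc : ContinuousOn w (Icc T₁ T₂) := hc.p_cont.mul hv
  have du : ∀ t ∈ Ico T₁ T₂, HasDerivWithinAt u (w t / p t) (Ici t) t := fun t ht => by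
    have ht' := Ico_subset_Icc_self ht
    have : w t / p t = v t := mul_div_cancel_left₀ _ (hc.p_pos t ht').ne'
    rw [this]
    exact (huv t ht').Ici_of_Icc ht
  set W : ℝ → ℝ := fun t => q t * u t - (a * m t * max (u t) 0 - b * n t * max (-u t) 0)
  have hW : ContinuousOn W (Icc T₁ T₂) := by
    have hu1 : ContinuousOn (fun t => max (u t) 0) (Icc T₁ T₂) := hu.sup continuousOn_const
    have hu2 : ContinuousOn (fun t => max (-u t) 0) (Icc T₁ T₂) := hu.neg.sup continuousOn_const
    exact (hc.q_cont.mul hu).sub ((hab.f_cont.mul hu1).sub (hab.g_cont.mul hu2))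
  have dw' : ∀ t ∈ Ioo T₁ T₂, HasDerivAt w (W t) t := fun t ht => by
    obtain ⟨z, hz, he⟩ := hw t ht
    have : W t = z := by simp only [W]; linarith
    rwa [this]
  -- At T₁ the equation is not assumed; the right derivative there is the limit of the derivatives
  -- from the interior.
  have dw : ∀ t ∈ Ico T₁ T₂, HasDerivWithinAt w (W t) (Ici t) t := fun t ht => by
    rcases ht.1.eq_or_lt with rfl | hlt
    · have hs : Ioo T₁ T₂ ∈ 𝓝[>] T₁ := Ioo_mem_nhdsGT hT
      refine hasDerivWithinAt_Ici_of_tendsto_deriv (s := Ioo T₁ T₂)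
        (fun t ht => (dw' t ht).differentiableAt.differentiableWithinAt)
        ((hwc T₁ hl).mono Ioo_subset_Icc_self) hs ?_
      have h1 : Tendsto W (𝓝[>] T₁) (𝓝 (W T₁)) :=
        ((hW T₁ hl).mono Ioo_subset_Icc_self).tendsto.mono_left (le_of_eq (nhdsWithin_Ioo_eq_nhdsGT hT).symm)
      refine h1.congr' ?_
      filter_upwards [hs] with t ht
      exact (dw' t ht).deriv.symm
    · exact (dw' t ⟨hlt, ht.2⟩).hasDerivWithinAt
  have hw1 : w T₁ = 0 := by simp [w, hv1]
  have hw2 : w T₂ = 0 := by simp [w, hv2]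
  have hu2 : u T₂ ≠ 0 := by
    cases σ
    · exact ne_of_gt hsgn
    · exact ne_of_lt hsgn
  have hu1 : u T₁ ≠ 0 := by
    intro h0
    refine hu2 (system_unique hab hu hwc (u₁ := fun _ => 0) (w₁ := fun _ => 0) continuousOn_const
      continuousOn_const du dw (fun t _ => ?_) (fun t _ => ?_) h0 hw1 T₂ hr).1
    · simpa using hasDerivWithinAt_const t (Ici t) (0 : ℝ)
    · simpa using hasDerivWithinAt_const t (Ici t) (0 : ℝ)
  obtain ⟨i, hi⟩ : ∃ i : ℤ, u T₁ = |u T₁| * Real.cos (i * Real.pi) := by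
    rcases hu1.lt_or_gt with h | h
    · exact ⟨1, by simp [abs_of_neg h]⟩
    · exact ⟨0, by simp [abs_of_pos h]⟩
  obtain ⟨φ, hφ, hφ0⟩ := exists_isAngle hT.le hab (i * Real.pi)
  obtain ⟨R, hR, hR0, hd⟩ := hφ.exists_polar hT.le hab (abs_pos.2 hu1)
  have heq := system_unique hab hu hwc (u₁ := fun s => R s * Real.cos (φ s))
    (w₁ := fun s => -(R s * Real.sin (φ s))) (fun t ht => (hd t ht).1.continuousWithinAt)
    (fun t ht => (hd t ht).2.continuousWithinAt) du dw
    (fun t ht => (hd t (Ico_subset_Icc_self ht)).1.Ici_of_Icc ht)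
    (fun t ht => (hd t (Ico_subset_Icc_self ht)).2.Ici_of_Icc ht)
    (by rw [hR0, hφ0]; exact hi) (by simp [hw1, hφ0])
  have hsin : Real.sin (φ T₂) = 0 := by
    have := (heq T₂ hr).2
    rw [hw2] at this
    have := mul_eq_zero.1 (neg_eq_zero.1 this.symm)
    exact this.resolve_left (hR T₂).ne'
  obtain ⟨j, hj⟩ := Real.sin_eq_zero_iff.1 hsin
  have hcos : HasSign σ (Real.cos (j * Real.pi)) := by
    have h1 := (heq T₂ hr).1
    rw [← hj] at h1
    cases σ
    · have h2 : 0 < u T₂ := hsgn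
      rw [h1] at h2
      exact pos_of_mul_pos_right h2 (hR _).le
    · have h2 : u T₂ < 0 := hsgn
      rw [h1] at h2
      exact (pos_iff_neg_of_mul_neg h2).1 (hR _)
  -- The sign of u(T₂) fixes the parity of j, so jπ and the normalized end angle differ by a
  -- multiple of 2π.
  obtain ⟨l, hl⟩ : ∃ l : ℤ, (j : ℝ) * Real.pi + l * (2 * Real.pi) = endAngle σ := by
    rcases Int.even_or_odd' j with ⟨l, rfl | rfl⟩
    · have h1 : Real.cos (((2 * l : ℤ) : ℝ) * Real.pi) = 1 := by
        have : ((2 * l : ℤ) : ℝ) * Real.pi = l * (2 * Real.pi) := by push_cast; ring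
        rw [this, Real.cos_int_mul_two_pi]
      rw [h1] at hcos
      cases σ
      · exact ⟨-l, by simp only [endAngle]; push_cast; ring⟩
      · exact absurd hcos (by simp [HasSign])
    · have h1 : Real.cos (((2 * l + 1 : ℤ) : ℝ) * Real.pi) = -1 := by
        have : ((2 * l + 1 : ℤ) : ℝ) * Real.pi = l * (2 * Real.pi) + Real.pi := by push_cast; ring
        rw [this, Real.cos_int_mul_two_pi_add_pi]
      rw [h1] at hcos
      cases σ
      · exact absurd hcos (by simp [HasSign])
      · exact ⟨-l, by simp only [endAngle]; push_cast; ring⟩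
  -- Otherwise the angle would start above the level jπ + π/2 and end below it. This makes `(j -
  -- i).toNat` the true difference.
  have hij : i ≤ j := by
    by_contra! hlt
    have hlt' : (j : ℝ) + 1 ≤ i := by exact_mod_cast hlt
    have hmul : ((j : ℝ) + 1) * Real.pi ≤ i * Real.pi := by gcongr
    have hx : Real.cos (j * Real.pi + Real.pi / 2) = 0 := by
      rw [Real.cos_add_pi_div_two, Real.sin_int_mul_pi, neg_zero]
    have := hφ.level_lt hab hx (by rw [hφ0]; linarith) ⟨hT, le_rfl⟩
    rw [← hj] at this
    linarith
  have hcast : (((j - i).toNat : ℕ) : ℝ) = j - i := by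
    have : (((j - i).toNat : ℤ) : ℝ) = ((j - i : ℤ) : ℝ) := by
      rw [Int.toNat_of_nonneg (by omega)]
    rw [← Int.cast_natCast, this]; push_cast; ring
  have hcount := hφ.encard_zeros hT hab (j := j) (k := (j - i).toNat)
    (by rw [hφ0, hcast]; ring) hj.symm
  have hset : {t | t ∈ Ioo T₁ T₂ ∧ u t = 0} = {t | t ∈ Ioo T₁ T₂ ∧ Real.cos (φ t) = 0} := by
    ext t
    refine and_congr_right fun ht => ?_
    rw [(heq t (Ioo_subset_Icc_self ht)).1]
    simp [(hR t).ne']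
  rw [hset, hcount] at hcard
  have hk : (j - i).toNat = k := by exact_mod_cast hcard
  rw [hk] at hcast
  refine ⟨_, hφ.add_int_mul_two_pi l, ?_, ?_⟩
  · simp only [hφ0, ← hl, hcast]; ring
  · simp only [← hj, hl]

theorem mem_curve_iff (hT : T₁ < T₂) (hc : Coeffs p q m n T₁ T₂) :
    (a, b) ∈ curve T₁ T₂ p q m n σ k ↔
      ∃ θ, IsAngle p q (fun t => a * m t) (fun t => b * n t) T₁ T₂ θ ∧
        θ T₁ = endAngle σ - k * Real.pi ∧ θ T₂ = endAngle σ :=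
  ⟨exists_isAngle_of_mem_curve hT hc, fun ⟨_, h, h0, h1⟩ => mem_curve_of_isAngle hT hc h h0 h1⟩

end Fucik

namespace Fucik
open Set Filter Topology

variable {p q f g : ℝ → ℝ} {α β : ℝ}

/-! ### Stretching an angle -/

/-- The angle obtained from `x` by multiplying its tangent by `κ`. -/
noncomputable def stretch (κ x : ℝ) : ℝ :=
  x + Real.arctan ((κ - 1) * (Real.sin x * Real.cos x) / (Real.cos x ^ 2 + κ * Real.sin x ^ 2))

/-- The map that is `stretch κ` where the cosine is negative and the identity elsewhere. -/
noncomputable def halfStretch (κ x : ℝ) : ℝ :=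
  x + Real.arctan
    ((κ - 1) * (Real.sin x * min (Real.cos x) 0) / (Real.cos x ^ 2 + κ * Real.sin x ^ 2))

theorem cos_sq_add_mul_sin_sq_pos {κ : ℝ} (hκ : 0 < κ) (x : ℝ) :
    0 < Real.cos x ^ 2 + κ * Real.sin x ^ 2 := by
  rcases eq_or_ne (Real.sin x) 0 with h | h
  · have := Real.sin_sq_add_cos_sq x
    rw [h] at this ⊢
    nlinarith
  · positivity

/-- `stretch κ x` is the direction of (cos x, κ sin x): the arctangent is the angle from (cos x, sin
x) to that vector, whose cross and dot products are the numerator and denominator in the definition.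
-/
theorem cos_stretch {κ : ℝ} (hκ : 0 < κ) (x : ℝ) :
    Real.cos (stretch κ x) = Real.cos x / √(Real.cos x ^ 2 + κ ^ 2 * Real.sin x ^ 2) ∧
    Real.sin (stretch κ x) = κ * Real.sin x / √(Real.cos x ^ 2 + κ ^ 2 * Real.sin x ^ 2) := by
  set c := Real.cos x
  set s := Real.sin x
  have hsc : s ^ 2 + c ^ 2 = 1 := Real.sin_sq_add_cos_sq x
  have hD : 0 < c ^ 2 + κ * s ^ 2 := cos_sq_add_mul_sin_sq_pos hκ x
  have hE : 0 < c ^ 2 + κ ^ 2 * s ^ 2 := cos_sq_add_mul_sin_sq_pos (by positivity) x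
  have hsq : √(1 + ((κ - 1) * (s * c) / (c ^ 2 + κ * s ^ 2)) ^ 2)
      = √(c ^ 2 + κ ^ 2 * s ^ 2) / (c ^ 2 + κ * s ^ 2) := by
    have : 1 + ((κ - 1) * (s * c) / (c ^ 2 + κ * s ^ 2)) ^ 2
        = (c ^ 2 + κ ^ 2 * s ^ 2) / (c ^ 2 + κ * s ^ 2) ^ 2 := by
      field_simp
      linear_combination (c ^ 2 + κ ^ 2 * s ^ 2) * hsc
    rw [this, Real.sqrt_div hE.le, Real.sqrt_sq hD.le]
  have hE' : √(c ^ 2 + κ ^ 2 * s ^ 2) ≠ 0 := (Real.sqrt_pos.2 hE).ne'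
  rw [stretch, Real.cos_add, Real.sin_add, Real.cos_arctan, Real.sin_arctan]
  change c * (1 / √(1 + ((κ - 1) * (s * c) / (c ^ 2 + κ * s ^ 2)) ^ 2)) -
      s * ((κ - 1) * (s * c) / (c ^ 2 + κ * s ^ 2) /
        √(1 + ((κ - 1) * (s * c) / (c ^ 2 + κ * s ^ 2)) ^ 2)) = _ ∧
    s * (1 / √(1 + ((κ - 1) * (s * c) / (c ^ 2 + κ * s ^ 2)) ^ 2)) +
      c * ((κ - 1) * (s * c) / (c ^ 2 + κ * s ^ 2) /
        √(1 + ((κ - 1) * (s * c) / (c ^ 2 + κ * s ^ 2)) ^ 2)) = _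
  rw [hsq]
  constructor
  · field_simp
    linear_combination c * hsc
  · rw [one_div_div, div_div_div_cancel_right₀ hD.ne', ← mul_div_assoc, ← mul_div_assoc, ← add_div]
    congr 1
    linear_combination κ * s * hsc

theorem hasDerivAt_stretch {κ : ℝ} (hκ : 0 < κ) (x : ℝ) :
    HasDerivAt (stretch κ) (κ / (Real.cos x ^ 2 + κ ^ 2 * Real.sin x ^ 2)) x := by
  have hD : 0 < Real.cos x ^ 2 + κ * Real.sin x ^ 2 := cos_sq_add_mul_sin_sq_pos hκ x
  have hE : 0 < Real.cos x ^ 2 + κ ^ 2 * Real.sin x ^ 2 :=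
    cos_sq_add_mul_sin_sq_pos (by positivity) x
  have hs := Real.hasDerivAt_sin x
  have hc := Real.hasDerivAt_cos x
  have h1 := ((hs.fun_mul hc).const_mul (κ - 1)).fun_div
    ((hc.fun_pow 2).fun_add ((hs.fun_pow 2).const_mul κ)) hD.ne'
  refine ((hasDerivAt_id x).fun_add h1.arctan).congr_deriv ?_
  have hsc := Real.sin_sq_add_cos_sq x
  have hτ : 0 < (Real.cos x ^ 2 + κ * Real.sin x ^ 2) ^ 2 +
      ((κ - 1) * (Real.sin x * Real.cos x)) ^ 2 := by positivity
  have hτ' : (Real.cos x ^ 2 + κ * Real.sin x ^ 2) ^ 2 +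
      ((κ - 1) * (Real.sin x * Real.cos x)) ^ 2
      = Real.cos x ^ 2 + κ ^ 2 * Real.sin x ^ 2 := by
    linear_combination (Real.cos x ^ 2 + κ ^ 2 * Real.sin x ^ 2) * hsc
  have hτ'' : 1 + ((κ - 1) * (Real.sin x * Real.cos x) /
      (Real.cos x ^ 2 + κ * Real.sin x ^ 2)) ^ 2
      = (Real.cos x ^ 2 + κ ^ 2 * Real.sin x ^ 2) /
        (Real.cos x ^ 2 + κ * Real.sin x ^ 2) ^ 2 := by
    rw [← hτ']
    field_simp
  rw [hτ'']
  field_simp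
  push_cast
  ring_nf
  have hs2 : Real.sin x ^ 2 = 1 - Real.cos x ^ 2 := by linarith
  have hs4 : Real.sin x ^ 4 = (1 - Real.cos x ^ 2) ^ 2 := by rw [← hs2]; ring
  rw [hs2, hs4]
  ring

theorem halfStretch_of_cos_nonneg {κ x : ℝ} (h : 0 ≤ Real.cos x) : halfStretch κ x = x := by
  simp [halfStretch, min_eq_right h]

theorem halfStretch_of_cos_nonpos {κ x : ℝ} (h : Real.cos x ≤ 0) :
    halfStretch κ x = stretch κ x := by
  simp [halfStretch, stretch, min_eq_left h]

theorem stretch_of_mul_eq_zero {κ x : ℝ} (h : Real.sin x * Real.cos x = 0) : stretch κ x = x := by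
  simp [stretch, h]

theorem halfStretch_of_sin_eq_zero {κ x : ℝ} (h : Real.sin x = 0) : halfStretch κ x = x := by
  simp [halfStretch, h]

theorem continuous_halfStretch {κ : ℝ} (hκ : 0 < κ) : Continuous (halfStretch κ) := by
  refine continuous_id.add (Real.continuous_arctan.comp (Continuous.div ?_ ?_ fun x =>
    (cos_sq_add_mul_sin_sq_pos hκ x).ne'))
  · exact continuous_const.mul (Real.continuous_sin.mul (Real.continuous_cos.min continuous_const))
  · exact (Real.continuous_cos.pow 2).add (continuous_const.mul (Real.continuous_sin.pow 2))

theorem stretch_add_int_mul_pi (κ x : ℝ) (j : ℤ) :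
    stretch κ (x + j * Real.pi) = stretch κ x + j * Real.pi := by
  have h : Real.sin (x + j * Real.pi) * Real.cos (x + j * Real.pi) = Real.sin x * Real.cos x ∧
      Real.cos (x + j * Real.pi) ^ 2 = Real.cos x ^ 2 ∧
      Real.sin (x + j * Real.pi) ^ 2 = Real.sin x ^ 2 := by
    have hs : Real.sin (j * Real.pi) = 0 := Real.sin_int_mul_pi j
    have hc : Real.cos (j * Real.pi) ^ 2 = 1 := by
      have := Real.sin_sq_add_cos_sq (j * Real.pi)
      rw [hs] at this; linarith
    rw [Real.sin_add, Real.cos_add, hs]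
    refine ⟨?_, ?_, ?_⟩
    · linear_combination (Real.sin x * Real.cos x) * hc
    · linear_combination (Real.cos x ^ 2) * hc
    · linear_combination (Real.sin x ^ 2) * hc
  rw [stretch, stretch, h.1, h.2.1, h.2.2]
  ring

theorem stretch_pos {κ x : ℝ} (hκ : 1 ≤ κ) (hx : 0 < x) : 0 < stretch κ x := by
  rcases lt_or_ge x (Real.pi / 2) with h | h
  · have hs : 0 < Real.sin x := Real.sin_pos_of_pos_of_lt_pi hx (by linarith)
    have hc : 0 < Real.cos x := Real.cos_pos_of_mem_Ioo ⟨by linarith, h⟩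
    have hκ' : 0 ≤ κ - 1 := by linarith
    have : 0 ≤ Real.arctan ((κ - 1) * (Real.sin x * Real.cos x) /
        (Real.cos x ^ 2 + κ * Real.sin x ^ 2)) := by
      rw [Real.arctan_nonneg]
      positivity
    rw [stretch]
    linarith
  · rw [stretch]
    linarith [Real.neg_pi_div_two_lt_arctan ((κ - 1) * (Real.sin x * Real.cos x) /
      (Real.cos x ^ 2 + κ * Real.sin x ^ 2))]

/-- For x = π/2 + z below π, the displacement is downward by an arctangent of something at most tan
z, hence by at most z. From π on, a displacement smaller than π/2 is harmless. -/
theorem pi_div_two_le_stretch {κ x : ℝ} (hκ : 1 ≤ κ) (hx : Real.pi / 2 ≤ x) :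
    Real.pi / 2 ≤ stretch κ x := by
  rcases lt_or_ge x Real.pi with h | h
  · obtain ⟨z, rfl⟩ : ∃ z, x = z + Real.pi / 2 := ⟨x - Real.pi / 2, by ring⟩
    have hz0 : 0 ≤ z := by linarith
    have hz1 : z < Real.pi / 2 := by linarith
    have hs : 0 ≤ Real.sin z := Real.sin_nonneg_of_nonneg_of_le_pi hz0 (by linarith)
    have hc : 0 < Real.cos z := Real.cos_pos_of_mem_Ioo ⟨by linarith, hz1⟩
    have hD : 0 < Real.sin z ^ 2 + κ * Real.cos z ^ 2 := by
      have : 0 < κ := by linarith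
      positivity
    have hle : (κ - 1) * (Real.sin z * Real.cos z) / (Real.sin z ^ 2 + κ * Real.cos z ^ 2)
        ≤ Real.tan z := by
      rw [Real.tan_eq_sin_div_cos, div_le_div_iff₀ hD hc]
      nlinarith [mul_nonneg hs (sq_nonneg (Real.cos z)), mul_nonneg hs (sq_nonneg (Real.sin z))]
    have := Real.arctan_mono hle
    rw [Real.arctan_tan (by linarith) hz1] at this
    have he : (κ - 1) * (Real.cos z * -Real.sin z) / ((-Real.sin z) ^ 2 + κ * Real.cos z ^ 2)
        = -((κ - 1) * (Real.sin z * Real.cos z) / (Real.sin z ^ 2 + κ * Real.cos z ^ 2)) := by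
      rw [neg_sq]; ring
    rw [stretch, Real.sin_add_pi_div_two, Real.cos_add_pi_div_two, he, Real.arctan_neg]
    linarith
  · rw [stretch]
    linarith [Real.neg_pi_div_two_lt_arctan ((κ - 1) * (Real.sin x * Real.cos x) /
      (Real.cos x ^ 2 + κ * Real.sin x ^ 2))]

theorem halfStretch_eq_or (κ x : ℝ) : halfStretch κ x = x ∨ halfStretch κ x = stretch κ x :=
  (le_total 0 (Real.cos x)).imp halfStretch_of_cos_nonneg halfStretch_of_cos_nonpos

theorem int_mul_pi_lt_halfStretch {κ x : ℝ} (hκ : 1 ≤ κ) {j : ℤ} (hx : j * Real.pi < x) :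
    j * Real.pi < halfStretch κ x := by
  rcases halfStretch_eq_or κ x with h | h
  · rwa [h]
  · have h1 := stretch_pos hκ (sub_pos.2 hx)
    have h2 := stretch_add_int_mul_pi κ (x - j * Real.pi) j
    rw [sub_add_cancel] at h2
    rw [h, h2]
    linarith

theorem int_mul_pi_add_pi_div_two_le_halfStretch {κ x : ℝ} (hκ : 1 ≤ κ) {j : ℤ}
    (hx : j * Real.pi + Real.pi / 2 ≤ x) : j * Real.pi + Real.pi / 2 ≤ halfStretch κ x := by
  rcases halfStretch_eq_or κ x with h | h
  · rwa [h]
  · have h1 := pi_div_two_le_stretch hκ (x := x - j * Real.pi) (by linarith)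
    have h2 := stretch_add_int_mul_pi κ (x - j * Real.pi) j
    rw [sub_add_cancel] at h2
    rw [h, h2]
    linarith

/-! ### Dependence on the weights, barriers and forced half turns -/

namespace IsAngle

variable {θ φ : ℝ → ℝ}

/-- After each instant, the cosine of an angle has constant sign for a while. -/
theorem eventually_cos (hc : Coeffs p q f g α β) (h : IsAngle p q f g α β θ) {t : ℝ}
    (ht : t ∈ Ico α β) :
    (∀ᶠ s in 𝓝[≥] t, 0 ≤ Real.cos (θ s)) ∨ (∀ᶠ s in 𝓝[≥] t, Real.cos (θ s) ≤ 0) := by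
  have hcont : ContinuousWithinAt θ (Ici t) t :=
    ((h t (Ico_subset_Icc_self ht)).Ici_of_Icc ht).continuousWithinAt
  have hcos : Tendsto (fun s => Real.cos (θ s)) (𝓝[≥] t) (𝓝 (Real.cos (θ t))) :=
    (Real.continuous_cos.tendsto _).comp hcont
  rcases lt_trichotomy (Real.cos (θ t)) 0 with h0 | h0 | h0
  · exact Or.inr ((hcos.eventually (gt_mem_nhds h0)).mono fun _ => le_of_lt)
  · have hmem : ∀ᶠ s in 𝓝[≥] t, 0 ≤ θ s - θ t ∧ θ s - θ t ≤ Real.pi := by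
      have h1 : ∀ᶠ s in 𝓝[≥] t, θ s < θ t + Real.pi :=
        hcont.tendsto.eventually (gt_mem_nhds (by linarith [Real.pi_pos]))
      filter_upwards [h1, Icc_mem_nhdsGE ht.2] with s hs1 hs2
      refine ⟨?_, by linarith⟩
      rcases hs2.1.eq_or_lt with rfl | hlt
      · simp
      · exact sub_nonneg.2 ((h.mono ht.1 le_rfl).level_lt (hc.mono ht.1 le_rfl) h0 le_rfl
          ⟨hlt, hs2.2⟩).le
    have hform (s : ℝ) : Real.cos (θ s) = -(Real.sin (θ t) * Real.sin (θ s - θ t)) := by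
      have : θ s = θ t + (θ s - θ t) := by ring
      rw [this, Real.cos_add, h0, add_sub_cancel_left]
      ring
    rcases le_total 0 (Real.sin (θ t)) with hs | hs
    · refine Or.inr (hmem.mono fun s hs' => ?_)
      rw [hform]
      have := mul_nonneg hs (Real.sin_nonneg_of_nonneg_of_le_pi hs'.1 hs'.2)
      linarith
    · refine Or.inl (hmem.mono fun s hs' => ?_)
      rw [hform]
      have := mul_nonneg (neg_nonneg.2 hs) (Real.sin_nonneg_of_nonneg_of_le_pi hs'.1 hs'.2)
      linarith
  · exact Or.inl ((hcos.eventually (lt_mem_nhds h0)).mono fun _ => le_of_lt)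

/-- Enlarging the coefficient of a weight on the negative side from `b₁` to `b₂` makes the angle
larger, once the tangents of the first angle have been multiplied by `b₂ / b₁` on that side. -/
theorem halfStretch_le {n : ℝ → ℝ} (hc : Coeffs p q f n α β) (hq : ∀ t ∈ Icc α β, 0 ≤ q t)
    {b₁ b₂ : ℝ} (hb₁ : 0 < b₁) (hb : b₁ ≤ b₂) (h₁ : IsAngle p q f (fun t => b₁ * n t) α β θ)
    (h₂ : IsAngle p q f (fun t => b₂ * n t) α β φ) (h0 : halfStretch (b₂ / b₁) (θ α) ≤ φ α) :
    ∀ t ∈ Icc α β, halfStretch (b₂ / b₁) (θ t) ≤ φ t := by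
  have hcb (b : ℝ) : Coeffs p q f (fun t => b * n t) α β :=
    ⟨hc.p_cont, hc.q_cont, hc.f_cont, continuousOn_const.mul hc.g_cont, hc.p_pos⟩
  obtain ⟨κ, hκ⟩ : ∃ κ, κ = b₂ / b₁ := ⟨_, rfl⟩
  rw [← hκ] at h0 ⊢
  have hκ1 : 1 ≤ κ := hκ ▸ (one_le_div hb₁).2 hb
  have hκ0 : 0 < κ := by linarith
  have hb₂ : b₂ = κ * b₁ := by rw [hκ]; field_simp
  have key : ∀ t ∈ Ico α β, ∃ d, HasDerivWithinAt (fun s => halfStretch κ (θ s)) d (Ici t) t ∧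
      d ≤ field p q f (fun t => b₂ * n t) t (halfStretch κ (θ t)) := by
    intro t ht
    have ht' := Ico_subset_Icc_self ht
    have hd := (h₁ t ht').Ici_of_Icc ht
    rcases h₁.eventually_cos (hcb b₁) ht with hcos | hcos
    · have hcos0 : 0 ≤ Real.cos (θ t) := hcos.self_of_nhdsWithin (mem_Ici.2 le_rfl)
      refine ⟨_, hd.congr_of_eventuallyEq (hcos.mono fun s hs => halfStretch_of_cos_nonneg hs)
        (halfStretch_of_cos_nonneg hcos0), ?_⟩
      rw [halfStretch_of_cos_nonneg hcos0]
      simp [field, max_eq_right (neg_nonpos.2 hcos0)]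
    · have hcos0 : Real.cos (θ t) ≤ 0 := hcos.self_of_nhdsWithin (mem_Ici.2 le_rfl)
      refine ⟨_, ((hasDerivAt_stretch hκ0 (θ t)).comp_hasDerivWithinAt t hd).congr_of_eventuallyEq
        (hcos.mono fun s hs => halfStretch_of_cos_nonpos hs)
        (halfStretch_of_cos_nonpos hcos0), ?_⟩
      rw [halfStretch_of_cos_nonpos hcos0]
      obtain ⟨ec, es⟩ := cos_stretch hκ0 (θ t)
      have hE : 0 < Real.cos (θ t) ^ 2 + κ ^ 2 * Real.sin (θ t) ^ 2 :=
        cos_sq_add_mul_sin_sq_pos (by positivity) _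
      have hcs : Real.cos (stretch κ (θ t)) ≤ 0 := by
        rw [ec]; exact div_nonpos_of_nonpos_of_nonneg hcos0 (Real.sqrt_nonneg _)
      have hp := hc.p_pos t ht'
      have hqt := hq t ht'
      simp only [field, max_eq_right hcos0, max_eq_right hcs, max_eq_left (neg_nonneg.2 hcos0),
        max_eq_left (neg_nonneg.2 hcs)]
      rw [neg_sq, neg_sq, es, ec, div_pow, div_pow, Real.sq_sqrt hE.le, ← sub_nonneg, hb₂]
      -- The weight cancels from the difference of the two sides; what remains is nonnegative
      -- because κ ≥ 1, p > 0 and q ≥ 0.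
      have : (κ * Real.sin (θ t)) ^ 2 / (Real.cos (θ t) ^ 2 + κ ^ 2 * Real.sin (θ t) ^ 2) / p t
          + f t * 0 ^ 2 + κ * b₁ * n t *
            (Real.cos (θ t) ^ 2 / (Real.cos (θ t) ^ 2 + κ ^ 2 * Real.sin (θ t) ^ 2))
          - q t * (Real.cos (θ t) ^ 2 / (Real.cos (θ t) ^ 2 + κ ^ 2 * Real.sin (θ t) ^ 2))
          - κ / (Real.cos (θ t) ^ 2 + κ ^ 2 * Real.sin (θ t) ^ 2) *
            (Real.sin (θ t) ^ 2 / p t + f t * 0 ^ 2 + b₁ * n t * Real.cos (θ t) ^ 2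
              - q t * Real.cos (θ t) ^ 2)
          = (κ - 1) * (κ * Real.sin (θ t) ^ 2 / p t + q t * Real.cos (θ t) ^ 2) /
            (Real.cos (θ t) ^ 2 + κ ^ 2 * Real.sin (θ t) ^ 2) := by
        field_simp
        ring
      rw [this]
      have : 0 ≤ κ - 1 := by linarith
      positivity
  choose! d hd hle using key
  exact h₂.subsolution_le (hcb b₂) ((continuous_halfStretch hκ0).comp_continuousOn h₁.continuousOn)
    hd hle h0

/-- The stretched angle lies below φ, and stretching with κ ≥ 1 never brings an angle back through a
multiple of π or an odd multiple of π/2. Starting where the sine vanishes makes the initial values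
agree. -/
theorem levels_mono_neg {n : ℝ → ℝ} (hc : Coeffs p q f n α β) (hq : ∀ t ∈ Icc α β, 0 ≤ q t)
    {b₁ b₂ : ℝ} (hb₁ : 0 < b₁) (hb : b₁ ≤ b₂) (h₁ : IsAngle p q f (fun t => b₁ * n t) α β θ)
    (h₂ : IsAngle p q f (fun t => b₂ * n t) α β φ) (hs : Real.sin (θ α) = 0) (h0 : φ α = θ α)
    {t : ℝ} (ht : t ∈ Icc α β) (j : ℤ) :
    (j * Real.pi < θ t → j * Real.pi < φ t) ∧
    (j * Real.pi + Real.pi / 2 ≤ θ t → j * Real.pi + Real.pi / 2 ≤ φ t) := by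
  have key := h₁.halfStretch_le hc hq hb₁ hb h₂ (by rw [halfStretch_of_sin_eq_zero hs, h0]) t ht
  have hκ : 1 ≤ b₂ / b₁ := (one_le_div hb₁).2 hb
  exact ⟨fun h => (int_mul_pi_lt_halfStretch hκ h).trans_le key,
    fun h => (int_mul_pi_add_pi_div_two_le_halfStretch hκ h).trans key⟩

theorem levels_mono_pos {m : ℝ → ℝ} (hc : Coeffs p q m g α β) (hq : ∀ t ∈ Icc α β, 0 ≤ q t)
    {a₁ a₂ : ℝ} (ha₁ : 0 < a₁) (ha : a₁ ≤ a₂) (h₁ : IsAngle p q (fun t => a₁ * m t) g α β θ)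
    (h₂ : IsAngle p q (fun t => a₂ * m t) g α β φ) (hs : Real.sin (θ α) = 0) (h0 : φ α = θ α)
    {t : ℝ} (ht : t ∈ Icc α β) (j : ℤ) :
    (j * Real.pi < θ t → j * Real.pi < φ t) ∧
    (j * Real.pi + Real.pi / 2 ≤ θ t → j * Real.pi + Real.pi / 2 ≤ φ t) := by
  have key := h₁.add_pi.levels_mono_neg hc.swap hq ha₁ ha h₂.add_pi (by simp [hs])
    (by simp [h0]) ht (j + 1)
  push_cast at key
  exact ⟨fun h => by linarith [key.1 (by linarith)], fun h => by linarith [key.2 (by linarith)]⟩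

/-- Without a weight on the negative side, the angle cannot cross odd multiples of `π`. -/
theorem lt_of_weight_eq_zero (hc : Coeffs p q f g α β) (hq : ∀ t ∈ Icc α β, 0 ≤ q t)
    (hg : ∀ t ∈ Icc α β, g t = 0) (h : IsAngle p q f g α β θ) {x : ℝ} (hx : Real.cos x = -1) :
    (θ α < x → ∀ t ∈ Icc α β, θ t < x) ∧ (θ α ≤ x → ∀ t ∈ Icc α β, θ t ≤ x) := by
  have hs : Real.sin x = 0 := by
    have := Real.sin_sq_add_cos_sq x
    rw [hx] at this
    exact pow_eq_zero_iff two_ne_zero |>.1 (by linarith)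
  have hle : ∀ t ∈ Ico α β, field p q f g t x ≤ 0 := fun t ht => by
    have ht' := Ico_subset_Icc_self ht
    simp [field, hs, hx, hg t ht', hq t ht']
  exact ⟨h.lt_supersolution hc (φ := fun _ => x) continuousOn_const
      (fun t _ => hasDerivWithinAt_const t _ x) hle,
    h.le_supersolution hc (φ := fun _ => x) continuousOn_const
      (fun t _ => hasDerivWithinAt_const t _ x) hle⟩

/-- An angle has to cross `0` in order to pass a point of the positive side where `f > q`. -/
theorem exists_lt_weight (hαβ : α < β) (hc : Coeffs p q f g α β) (h : IsAngle p q f g α β θ)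
    (h0 : θ α ≤ -(Real.pi / 2)) (h1 : θ β = 0) :
    ∃ s ∈ Ioo α β, q s < f s ∧ -(Real.pi / 2) ≤ θ s := by
  have hpi := Real.pi_pos
  -- From γ on the angle stays above -π/2. If f ≤ q held at all those times, the constant 0 would be
  -- a strict barrier. Any value between -π/2 and 0 would serve as well as -π/4.
  obtain ⟨γ, hγ, hγθ⟩ := intermediate_value_Ioo hαβ.le h.continuousOn
    (show -(Real.pi / 4) ∈ Ioo (θ α) (θ β) by rw [h1]; constructor <;> linarith)
  have hc' := hc.mono hγ.1.le le_rfl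
  have h' := h.mono hγ.1.le le_rfl
  by_contra! hcon
  have hle : ∀ t ∈ Ico γ β, field p q f g t 0 ≤ 0 := fun t ht => by
    have hlev : -(Real.pi / 2) ≤ θ t := by
      rcases ht.1.eq_or_lt with rfl | hlt
      · linarith
      · exact (h'.level_lt hc' (by simp) (by linarith) ⟨hlt, ht.2.le⟩).le
    have : f t ≤ q t := by
      by_contra! hlt
      exact absurd hlev (not_le.2 (hcon t ⟨hγ.1.trans_le ht.1, ht.2⟩ hlt))
    simpa [field] using this
  have := h'.lt_supersolution hc' (φ := fun _ => 0) continuousOn_const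
    (fun t _ => hasDerivWithinAt_const t _ 0) hle (by simp only [hγθ]; linarith) β
    (right_mem_Icc.2 hγ.2.le)
  simp [h1] at this

/-- A large weight forces the angle through a whole half turn. -/
theorem half_turn (hαβ : α < β) (hc : Coeffs p q f g α β) (h : IsAngle p q f g α β θ) {P : ℝ}
    (hP : ∀ t ∈ Icc α β, p t ≤ P)
    (hf : ∀ t ∈ Icc α β, (Real.pi / (β - α)) ^ 2 * P + q t ≤ f t)
    (h0 : -(Real.pi / 2) ≤ θ α) : Real.pi / 2 ≤ θ β := by
  have hpi := Real.pi_pos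
  have hPpos : 0 < P := (hc.p_pos α (left_mem_Icc.2 hαβ.le)).trans_le
    (hP α (left_mem_Icc.2 hαβ.le))
  have hd : 0 < β - α := by linarith
  set ω := Real.pi / (β - α) with hω
  have hω0 : 0 < ω := by positivity
  set κ := ω * P with hκ
  have hκ0 : 0 < κ := by positivity
  have hωd : ω * (β - α) = Real.pi := by rw [hω]; field_simp
  -- This is the phase of sin(ω(t - α)), a solution of -(P u')' = ω²P u. Stretching by κ = ωP turns
  -- it into the Prüfer angle of that comparison equation.
  set ψ : ℝ → ℝ := fun t => ω * (t - α) - Real.pi / 2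
  have hψ (t : ℝ) : HasDerivAt ψ ω t := by
    exact ((((hasDerivAt_id t).sub_const α).const_mul ω).sub_const (Real.pi / 2)).congr_deriv
      (mul_one ω)
  have hsψ (t : ℝ) := (hasDerivAt_stretch hκ0 (ψ t)).comp t (hψ t)
  have hψα : ψ α = -(Real.pi / 2) := by simp [ψ]
  have hψβ : ψ β = Real.pi / 2 := by simp only [ψ, hωd]; ring
  have key := h.subsolution_le hc (φ := fun t => stretch κ (ψ t))
    (fun t _ => (hsψ t).continuousAt.continuousWithinAt) (fun t _ => (hsψ t).hasDerivWithinAt)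
    (fun t ht => ?_) (by
      simp only [hψα]
      rwa [stretch_of_mul_eq_zero (by simp)]) β (right_mem_Icc.2 hαβ.le)
  · simp only [hψβ] at key
    rwa [stretch_of_mul_eq_zero (by simp)] at key
  · have ht' := Ico_subset_Icc_self ht
    have hlo : 0 ≤ ω * (t - α) := mul_nonneg hω0.le (by linarith [ht.1])
    have hhi : ω * (t - α) ≤ ω * (β - α) := by
      have := ht.2.le
      gcongr
    have hcos0 : 0 ≤ Real.cos (ψ t) := Real.cos_nonneg_of_mem_Icc
      ⟨by simp only [ψ]; linarith, by simp only [ψ]; linarith⟩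
    obtain ⟨ec, es⟩ := cos_stretch hκ0 (ψ t)
    have hE : 0 < Real.cos (ψ t) ^ 2 + κ ^ 2 * Real.sin (ψ t) ^ 2 :=
      cos_sq_add_mul_sin_sq_pos (by positivity) _
    have hcs : 0 ≤ Real.cos (stretch κ (ψ t)) := by
      rw [ec]; exact div_nonneg hcos0 (Real.sqrt_nonneg _)
    have hp := hc.p_pos t ht'
    simp only [field, max_eq_left hcs, max_eq_right (neg_nonpos.2 hcs)]
    rw [es, ec, div_pow, div_pow, Real.sq_sqrt hE.le]
    have e1 : (κ * Real.sin (ψ t)) ^ 2 / (Real.cos (ψ t) ^ 2 + κ ^ 2 * Real.sin (ψ t) ^ 2) / p t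
        + f t * (Real.cos (ψ t) ^ 2 / (Real.cos (ψ t) ^ 2 + κ ^ 2 * Real.sin (ψ t) ^ 2))
        + g t * 0 ^ 2
        - q t * (Real.cos (ψ t) ^ 2 / (Real.cos (ψ t) ^ 2 + κ ^ 2 * Real.sin (ψ t) ^ 2))
        = (κ ^ 2 / p t * Real.sin (ψ t) ^ 2 + (f t - q t) * Real.cos (ψ t) ^ 2) /
          (Real.cos (ψ t) ^ 2 + κ ^ 2 * Real.sin (ψ t) ^ 2) := by
      ring
    have e2 : κ / (Real.cos (ψ t) ^ 2 + κ ^ 2 * Real.sin (ψ t) ^ 2) * ω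
        = (ω * κ * Real.sin (ψ t) ^ 2 + ω * κ * Real.cos (ψ t) ^ 2) /
          (Real.cos (ψ t) ^ 2 + κ ^ 2 * Real.sin (ψ t) ^ 2) := by
      rw [← mul_add, Real.sin_sq_add_cos_sq]; ring
    rw [e1, e2]
    have h1 : ω * κ ≤ κ ^ 2 / p t := by
      rw [le_div_iff₀ hp]
      have := mul_le_mul_of_nonneg_left (hP t ht') (mul_pos hω0 hκ0).le
      calc ω * κ * p t ≤ ω * κ * P := this
        _ = κ ^ 2 := by rw [hκ]; ring
    have h2 : ω * κ ≤ f t - q t := by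
      have := hf t ht'
      have : ω * κ = ω ^ 2 * P := by rw [hκ]; ring
      linarith
    gcongr

end IsAngle

end Fucik

namespace Fucik
open Set Filter Topology

variable {p q f g m n : ℝ → ℝ} {T₁ T₂ a b : ℝ} {k : ℕ} {σ τ : Sgn}

/-! ### Symmetries of the curves -/

theorem swap_mem_curve_pos (hT : T₁ < T₂) (hc : Coeffs p q m n T₁ T₂)
    (h : (a, b) ∈ curve T₁ T₂ p q m n Sgn.neg k) : (b, a) ∈ curve T₁ T₂ p q n m Sgn.pos k := by
  obtain ⟨θ, hθ, h0, h1⟩ := (mem_curve_iff hT hc).1 h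
  refine (mem_curve_iff hT hc.swap).2 ⟨_, hθ.add_pi.add_int_mul_two_pi (-1), ?_, ?_⟩
  · simp only [h0, endAngle]; push_cast; ring
  · simp only [h1, endAngle]; push_cast; ring

/-- The number `1` or `-1` with the given sign. -/
def Sgn.val : Sgn → ℝ
  | Sgn.pos => 1
  | Sgn.neg => -1

theorem Sgn.val_mul_val (ε : Sgn) : ε.val * ε.val = 1 := by
  cases ε <;> simp [Sgn.val]

theorem mem_halfLine_iff (ε : Sgn) (x : ℝ) : x ∈ halfLine ε ↔ 0 ≤ ε.val * x := by
  cases ε <;> simp [halfLine, Sgn.val]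

theorem mem_quadrant_iff (ε₁ ε₂ : Sgn) :
    (a, b) ∈ quadrant ε₁ ε₂ ↔ 0 ≤ ε₁.val * a ∧ 0 ≤ ε₂.val * b := by
  rw [quadrant, mem_prod, mem_halfLine_iff, mem_halfLine_iff]

/-- Only the products a m and b n enter the equation, so sign changes can be moved into the weights.
-/
theorem mem_curve_val_iff (ε₁ ε₂ : Sgn) : (ε₁.val * a, ε₂.val * b) ∈
      curve T₁ T₂ p q (fun t => ε₁.val * m t) (fun t => ε₂.val * n t) σ k ↔
    (a, b) ∈ curve T₁ T₂ p q m n σ k := by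
  have key (ε : Sgn) (x y : ℝ) : ε.val * x * (ε.val * y) = x * y := by
    rw [mul_mul_mul_comm, ε.val_mul_val, one_mul]
  simp only [curve, IsSolution, mem_ofPred_eq, key]

/-! ### Neighbouring curves -/

/-- The barrier is -π for σ = + and π for σ = -. With k ≥ 1 the start is at most -π in the first
case and strictly below π in the second. -/
theorem lt_endAngle_of_weight_eq_zero (hT : T₁ < T₂) (hc : Coeffs p q f g T₁ T₂)
    (hq : ∀ t ∈ Icc T₁ T₂, 0 ≤ q t) (hg : ∀ t ∈ Icc T₁ T₂, g t = 0) (hk : 1 ≤ k) {θ : ℝ → ℝ}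
    (h : IsAngle p q f g T₁ T₂ θ) (h0 : θ T₁ = endAngle σ - k * Real.pi) :
    θ T₂ < endAngle σ := by
  have hpi := Real.pi_pos
  have hr : T₂ ∈ Icc T₁ T₂ := right_mem_Icc.2 hT.le
  have hk' : Real.pi ≤ k * Real.pi := le_mul_of_one_le_left hpi.le (by exact_mod_cast hk)
  cases σ
  · simp only [endAngle] at h0 ⊢
    have := (h.lt_of_weight_eq_zero hc hq hg (x := -Real.pi) (by simp)).2 (by linarith) T₂ hr
    linarith
  · simp only [endAngle] at h0 ⊢
    exact (h.lt_of_weight_eq_zero hc hq hg Real.cos_pi).1 (by linarith) T₂ hr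

theorem exists_mem_curve_of_endAngle_le (hT : T₁ < T₂) (hc : Coeffs p q m n T₁ T₂)
    (hq : ∀ t ∈ Icc T₁ T₂, 0 ≤ q t) (hk : 1 ≤ k) (hb : 0 ≤ b) {θ : ℝ → ℝ}
    (h : IsAngle p q (fun t => a * m t) (fun t => b * n t) T₁ T₂ θ)
    (h0 : θ T₁ = endAngle σ - k * Real.pi) (h1 : endAngle σ ≤ θ T₂) :
    ∃ b', 0 ≤ b' ∧ (a, b') ∈ curve T₁ T₂ p q m n σ k := by
  have hr : T₂ ∈ Icc T₁ T₂ := right_mem_Icc.2 hT.le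
  have hca : Coeffs p q (fun t => a * m t) n T₁ T₂ :=
    ⟨hc.p_cont, hc.q_cont, continuousOn_const.mul hc.f_cont, hc.g_cont, hc.p_pos⟩
  obtain ⟨Θ, hΘ, hsol⟩ := exists_angle_continuous hT.le hca (endAngle σ - k * Real.pi)
  obtain ⟨φ, hφ, hφ0, hφ1⟩ := hsol 0
  obtain ⟨ψ, hψ, hψ0, hψ1⟩ := hsol b
  have e0 : Θ 0 ≤ endAngle σ := by
    rw [← hφ1]
    exact (lt_endAngle_of_weight_eq_zero hT (hc.of_smul a 0) hq (by simp) hk hφ hφ0).le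
  have e1 : endAngle σ ≤ Θ b := by
    rw [← hψ1, hψ.eqOn (hc.of_smul a b) h (by rw [hψ0, h0]) T₂ hr]
    exact h1
  obtain ⟨b', hb', he⟩ := intermediate_value_Icc hb hΘ.continuousOn ⟨e0, e1⟩
  obtain ⟨χ, hχ, hχ0, hχ1⟩ := hsol b'
  exact ⟨b', hb'.1, mem_curve_of_isAngle hT hc hχ hχ0 (hχ1.trans he)⟩

/-- If σ ≠ τ, this is the given angle up to a multiple of 2π, and it ends π beyond the target. If σ
= τ, it starts π above the given angle and stays strictly above it. -/
theorem exists_isAngle_endAngle_lt (hT : T₁ < T₂) (hc : Coeffs p q m n T₁ T₂)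
    (h : (a, b) ∈ curve T₁ T₂ p q m n τ (k + 1)) (σ : Sgn) :
    ∃ θ, IsAngle p q (fun t => a * m t) (fun t => b * n t) T₁ T₂ θ ∧
      θ T₁ = endAngle σ - k * Real.pi ∧ endAngle σ < θ T₂ := by
  have hpi := Real.pi_pos
  have hab := hc.of_smul a b
  have hr : T₂ ∈ Icc T₁ T₂ := right_mem_Icc.2 hT.le
  obtain ⟨θ, hθ, h0, h1⟩ := (mem_curve_iff hT hc).1 h
  obtain ⟨φ, hφ, hφ0⟩ := exists_isAngle hT.le hab (endAngle σ - k * Real.pi)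
  push_cast at h0
  refine ⟨φ, hφ, hφ0, ?_⟩
  cases σ <;> cases τ <;> simp only [endAngle] at *
  · have := hθ.lt hab hφ (by linarith) T₂ hr
    linarith
  · have := hθ.eqOn hab hφ (by linarith) T₂ hr
    linarith
  · have := (hθ.add_int_mul_two_pi 1).eqOn hab hφ (by simp only [h0, hφ0]; push_cast; ring) T₂ hr
    push_cast at this
    linarith
  · have := hθ.lt hab hφ (by linarith) T₂ hr
    linarith

theorem curve_succ_above (hT : T₁ < T₂) (hc : Coeffs p q m n T₁ T₂)
    (hq : ∀ t ∈ Icc T₁ T₂, 0 ≤ q t) (hk : 1 ≤ k) (hb : 0 ≤ b)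
    (h : (a, b) ∈ curve T₁ T₂ p q m n τ (k + 1)) (σ : Sgn) :
    (∃ b', 0 ≤ b' ∧ (a, b') ∈ curve T₁ T₂ p q m n σ k) ∧
      ∀ b', (a, b') ∈ curve T₁ T₂ p q m n σ k → b' < b := by
  obtain ⟨θ, hθ, h0, h1⟩ := exists_isAngle_endAngle_lt hT hc h σ
  refine ⟨exists_mem_curve_of_endAngle_le hT hc hq hk hb hθ h0 h1.le, fun b' hb' => ?_⟩
  by_contra! hle
  -- The level comparison divides by b; at b = 0 the barrier contradicts the overshoot.
  have hb0 : 0 < b := by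
    refine hb.lt_of_ne' fun hb0 => ?_
    subst hb0
    exact absurd (lt_endAngle_of_weight_eq_zero hT (hc.of_smul a 0) hq (by simp) hk hθ h0)
      (not_lt.2 h1.le)
  obtain ⟨φ, hφ, hφ0, hφ1⟩ := (mem_curve_iff hT hc).1 hb'
  obtain ⟨j, hj⟩ := exists_endAngle_eq σ
  have hca : Coeffs p q (fun t => a * m t) n T₁ T₂ :=
    ⟨hc.p_cont, hc.q_cont, continuousOn_const.mul hc.f_cont, hc.g_cont, hc.p_pos⟩
  have hs : Real.sin (θ T₁) = 0 := by
    rw [h0, hj, ← sub_mul]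
    exact_mod_cast Real.sin_int_mul_pi (j - k)
  have := (hθ.levels_mono_neg hca hq hb0 hle hφ hs (by rw [hφ0, h0])
    (right_mem_Icc.2 hT.le) j).1 (by rwa [← hj])
  rw [hφ1, hj] at this
  exact lt_irrefl _ this

/-! ### Existence of the next curve -/

/-- By continuity m > m(s)/2 on a short interval [s, e], where a large A beats the bound of
`half_turn`. Both e and `A₀` are independent of the other weight and of the angle, so the two
coefficients can be enlarged separately. -/
theorem exists_forced_half_turn (hc : Coeffs p q m n T₁ T₂) {s d : ℝ} (hs : s ∈ Ioo T₁ T₂)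
    (hd : s < d) (hms : 0 < m s) :
    ∃ e, s < e ∧ e < d ∧ e < T₂ ∧ ∃ A₀, ∀ A, A₀ ≤ A → ∀ g θ, ContinuousOn g (Icc T₁ T₂) →
      IsAngle p q (fun t => A * m t) g T₁ T₂ θ → -(Real.pi / 2) ≤ θ s → Real.pi / 2 ≤ θ e := by
  obtain ⟨P, hP0, hP⟩ := exists_abs_le_of_continuousOn hc.p_cont
  obtain ⟨Q, hQ0, hQ⟩ := exists_abs_le_of_continuousOn hc.q_cont
  have hev : {t | m s / 2 < m t ∧ t < d ∧ t < T₂} ∈ 𝓝[≥] s := by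
    have h1 : ∀ᶠ t in 𝓝 s, m s / 2 < m t :=
      (hc.f_cont.continuousAt (Icc_mem_nhds hs.1 hs.2)).eventually (lt_mem_nhds (by linarith))
    exact mem_nhdsWithin_of_mem_nhds (h1.and ((gt_mem_nhds hd).and (gt_mem_nhds hs.2)))
  obtain ⟨e, he, hsub⟩ := mem_nhdsGE_iff_exists_Icc_subset.1 hev
  have hse : s < e := he
  have hee := hsub (right_mem_Icc.2 hse.le)
  refine ⟨e, hse, hee.2.1, hee.2.2, ((Real.pi / (e - s)) ^ 2 * P + Q) / (m s / 2),
    fun A hA g θ hg hθ h0 => ?_⟩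
  have hA' : (Real.pi / (e - s)) ^ 2 * P + Q ≤ A * (m s / 2) :=
    (div_le_iff₀ (by linarith)).1 hA
  have hA0 : 0 ≤ A := le_trans (by positivity) hA
  have hcA : Coeffs p q (fun t => A * m t) g T₁ T₂ :=
    ⟨hc.p_cont, hc.q_cont, continuousOn_const.mul hc.f_cont, hg, hc.p_pos⟩
  have hmem : ∀ t ∈ Icc s e, t ∈ Icc T₁ T₂ := fun t ht =>
    ⟨hs.1.le.trans ht.1, ht.2.trans hee.2.2.le⟩
  refine (hθ.mono hs.1.le hee.2.2.le).half_turn hse (hcA.mono hs.1.le hee.2.2.le)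
    (fun t ht => (le_abs_self _).trans (hP t (hmem t ht))) (fun t ht => ?_) h0
  have h1 : A * (m s / 2) ≤ A * m t := mul_le_mul_of_nonneg_left (hsub ht).1.le hA0
  have h2 := (le_abs_self _).trans (hQ t (hmem t ht))
  linarith

theorem exists_mem_curve_succ_of_le (hT : T₁ < T₂) (hc : Coeffs p q m n T₁ T₂)
    (hq : ∀ t ∈ Icc T₁ T₂, 0 ≤ q t) (ha : 0 < a) (hb : 0 < b) {θ : ℝ → ℝ}
    (hθ : IsAngle p q (fun t => a * m t) (fun t => b * n t) T₁ T₂ θ)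
    (h0 : θ T₁ = -(k * Real.pi)) {s r : ℝ} (hs : s ∈ Ioo T₁ T₂) (hms : 0 < m s)
    (hθs : -(Real.pi / 2) ≤ θ s) (hr : r ∈ Ioo T₁ T₂) (hnr : 0 < n r) (hsr : s ≤ r) :
    ∃ a' b', 0 ≤ a' ∧ 0 ≤ b' ∧ (a', b') ∈ curve T₁ T₂ p q m n Sgn.neg (k + 1) := by
  have hpi := Real.pi_pos
  -- s = r is possible; moving r slightly to the right leaves room for a half turn between s and r'.
  obtain ⟨r', hr', hnr', hsr'⟩ : ∃ r' ∈ Ioo T₁ T₂, 0 < n r' ∧ s < r' := by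
    have h1 : ∀ᶠ t in 𝓝 r, 0 < n t :=
      (hc.g_cont.continuousAt (Icc_mem_nhds hr.1 hr.2)).eventually (lt_mem_nhds hnr)
    obtain ⟨r', ⟨h2, h3⟩, h4⟩ := (((h1.and (Ioo_mem_nhds hr.1 hr.2)).filter_mono
      nhdsWithin_le_nhds).and (self_mem_nhdsWithin (s := Ioi r))).exists
    exact ⟨r', h3, h2, hsr.trans_lt h4⟩
  obtain ⟨e, hse, her', -, A₀, hA₀⟩ := exists_forced_half_turn hc hs hsr' hms
  obtain ⟨d, hrd, -, hdT, B₀, hB₀⟩ := exists_forced_half_turn hc.swap hr' hr'.2 hnr'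
  set A := max a A₀
  set B := max b B₀
  have hA : 0 < A := ha.trans_le (le_max_left _ _)
  have hB : 0 < B := hb.trans_le (le_max_left _ _)
  have hs' := Ioo_subset_Icc_self hs
  have hsin : Real.sin (θ T₁) = 0 := by
    rw [h0, Real.sin_neg, Real.sin_nat_mul_pi, neg_zero]
  -- Intermediate angle for (a, B): the level comparisons change one coefficient at a time.
  obtain ⟨φ, hφ, hφ0⟩ := exists_isAngle hT.le (hc.of_smul a B) (θ T₁)
  obtain ⟨ψ, hψ, hψ0⟩ := exists_isAngle hT.le (hc.of_smul A B) (θ T₁)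
  have hca : Coeffs p q (fun t => a * m t) n T₁ T₂ :=
    ⟨hc.p_cont, hc.q_cont, continuousOn_const.mul hc.f_cont, hc.g_cont, hc.p_pos⟩
  have hcB : Coeffs p q m (fun t => B * n t) T₁ T₂ :=
    ⟨hc.p_cont, hc.q_cont, hc.f_cont, continuousOn_const.mul hc.g_cont, hc.p_pos⟩
  have hAB := hc.of_smul A B
  have e1 := (hθ.levels_mono_neg hca hq hb (le_max_left _ _) hφ hsin hφ0 hs' (-1)).2
    (by push_cast; linarith)
  have e2 := (hφ.levels_mono_pos hcB hq ha (le_max_left _ _) hψ (by rw [hφ0, hsin])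
    (by rw [hψ0, hφ0]) hs' (-1)).2 e1
  push_cast at e2
  have e3 := hA₀ A (le_max_right _ _) _ ψ hAB.g_cont hψ (by linarith)
  have heT : T₁ ≤ e := hs.1.le.trans hse.le
  have e4 := (hψ.mono heT le_rfl).level_lt (hAB.mono heT le_rfl) Real.cos_pi_div_two e3
    ⟨her', hr'.2.le⟩
  -- Shifting by π - 2π exchanges the weights and moves the level π/2 to -π/2, so ψ reaches 3π/2 at
  -- d.
  have e5 := hB₀ B (le_max_right _ _) _ _ hAB.f_cont (hψ.add_pi.add_int_mul_two_pi (-1))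
    (by push_cast; linarith)
  push_cast at e5
  have hdT₁ : T₁ ≤ d := hr'.1.le.trans hrd.le
  have e6 := (hψ.mono hdT₁ le_rfl).level_lt (x := Real.pi / 2 + Real.pi) (hAB.mono hdT₁ le_rfl)
    (by rw [Real.cos_add_pi, Real.cos_pi_div_two, neg_zero]) (by linarith) ⟨hdT, le_rfl⟩
  obtain ⟨b', hb', hmem⟩ := exists_mem_curve_of_endAngle_le (σ := Sgn.neg) (k := k + 1) hT hc hq
    (by omega) hB.le hψ (by rw [hψ0, h0]; simp only [endAngle]; push_cast; ring)
    (by simp only [endAngle]; linarith)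
  exact ⟨A, b', hA.le, hb', hmem⟩

/-- A point of `C_k^>` with nonnegative coordinates has positive coordinates, and it has an angle
that passes a point where the positive weight is effective after the last zero. -/
theorem exists_angle_of_mem_curve_pos (hT : T₁ < T₂) (hc : Coeffs p q m n T₁ T₂)
    (hq : ∀ t ∈ Icc T₁ T₂, 0 ≤ q t) (hk : 1 ≤ k) (ha : 0 ≤ a) (hb : 0 ≤ b)
    (h : (a, b) ∈ curve T₁ T₂ p q m n Sgn.pos k) :
    0 < a ∧ 0 < b ∧ ∃ θ, IsAngle p q (fun t => a * m t) (fun t => b * n t) T₁ T₂ θ ∧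
      θ T₁ = -(k * Real.pi) ∧ ∃ s ∈ Ioo T₁ T₂, 0 < m s ∧ -(Real.pi / 2) ≤ θ s := by
  have hpi := Real.pi_pos
  have hk' : Real.pi ≤ k * Real.pi := le_mul_of_one_le_left hpi.le (by exact_mod_cast hk)
  have hab := hc.of_smul a b
  obtain ⟨θ, hθ, h0, h1⟩ := (mem_curve_iff hT hc).1 h
  have hb0 : b ≠ 0 := by
    rintro rfl
    exact (lt_endAngle_of_weight_eq_zero hT hab hq (by simp) hk hθ h0).ne h1
  simp only [endAngle, zero_sub] at h0 h1
  obtain ⟨s, hs, hfs, hθs⟩ := hθ.exists_lt_weight hT hab (by linarith) h1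
  have hpos : 0 < a * m s := (hq s (Ioo_subset_Icc_self hs)).trans_lt hfs
  have hms : 0 < m s := pos_of_mul_pos_right hpos ha
  exact ⟨pos_of_mul_pos_left hpos hms.le, hb.lt_of_ne' hb0, θ, hθ, h0, s, hs, hms, hθs⟩

theorem exists_mem_curve_succ (hT : T₁ < T₂) (hc : Coeffs p q m n T₁ T₂)
    (hq : ∀ t ∈ Icc T₁ T₂, 0 ≤ q t) (hk : 1 ≤ k) {a₁ b₁ a₂ b₂ : ℝ}
    (ha₁ : 0 ≤ a₁) (hb₁ : 0 ≤ b₁) (ha₂ : 0 ≤ a₂) (hb₂ : 0 ≤ b₂)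
    (h₁ : (a₁, b₁) ∈ curve T₁ T₂ p q m n Sgn.pos k)
    (h₂ : (a₂, b₂) ∈ curve T₁ T₂ p q m n Sgn.neg k) :
    ∃ σ a b, 0 ≤ a ∧ 0 ≤ b ∧ (a, b) ∈ curve T₁ T₂ p q m n σ (k + 1) := by
  obtain ⟨ha₁', hb₁', θ, hθ, hθ0, s, hs, hms, hθs⟩ :=
    exists_angle_of_mem_curve_pos hT hc hq hk ha₁ hb₁ h₁
  obtain ⟨hb₂', ha₂', φ, hφ, hφ0, r, hr, hnr, hφr⟩ :=
    exists_angle_of_mem_curve_pos hT hc.swap hq hk hb₂ ha₂ (swap_mem_curve_pos hT hc h₂)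
  rcases le_total s r with hsr | hsr
  · exact ⟨Sgn.neg,
      exists_mem_curve_succ_of_le hT hc hq ha₁' hb₁' hθ hθ0 hs hms hθs hr hnr hsr⟩
  · obtain ⟨b, a, hb, ha, h⟩ :=
      exists_mem_curve_succ_of_le hT hc.swap hq hb₂' ha₂' hφ hφ0 hr hnr hφr hs hms hsr
    exact ⟨Sgn.pos, a, b, ha, hb, swap_mem_curve_pos hT hc.swap h⟩

end Fucik

/-! ### The theorem, by reduction to nonnegative a and b -/

theorem theorem2 (T₁ T₂ : ℝ) (hT : T₁ < T₂) (p q m n : ℝ → ℝ)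
    (hp : ContinuousOn p (Set.Icc T₁ T₂)) (hq : ContinuousOn q (Set.Icc T₁ T₂))
    (hm : ContinuousOn m (Set.Icc T₁ T₂)) (hn : ContinuousOn n (Set.Icc T₁ T₂))
    (hp_pos : ∀ t ∈ Set.Icc T₁ T₂, 0 < p t) (hq_nonneg : ∀ t ∈ Set.Icc T₁ T₂, 0 ≤ q t)
    (hm_ne : ∃ t ∈ Set.Icc T₁ T₂, m t ≠ 0) (hn_ne : ∃ t ∈ Set.Icc T₁ T₂, n t ≠ 0)
    (k : ℕ) (hk : 1 ≤ k) :
    (∀ ε₁ ε₂ : Fucik.Sgn,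
      ((Fucik.curve T₁ T₂ p q m n Fucik.Sgn.pos k ∩ Fucik.quadrant ε₁ ε₂).Nonempty ∧
        (Fucik.curve T₁ T₂ p q m n Fucik.Sgn.neg k ∩ Fucik.quadrant ε₁ ε₂).Nonempty) ↔
      ((Fucik.curve T₁ T₂ p q m n Fucik.Sgn.pos (k + 1) ∩ Fucik.quadrant ε₁ ε₂).Nonempty ∨
        (Fucik.curve T₁ T₂ p q m n Fucik.Sgn.neg (k + 1) ∩ Fucik.quadrant ε₁ ε₂).Nonempty)) ∧
    (∀ σ τ ε : Fucik.Sgn, Fucik.LiesStrictlyAbove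
      (Fucik.curve T₁ T₂ p q m n τ (k + 1) ∩ Fucik.quadrant ε Fucik.Sgn.pos)
      (Fucik.curve T₁ T₂ p q m n σ k ∩ Fucik.quadrant ε Fucik.Sgn.pos)) ∧
    (∀ σ τ ε : Fucik.Sgn, Fucik.LiesStrictlyBelow
      (Fucik.curve T₁ T₂ p q m n τ (k + 1) ∩ Fucik.quadrant ε Fucik.Sgn.neg)
      (Fucik.curve T₁ T₂ p q m n σ k ∩ Fucik.quadrant ε Fucik.Sgn.neg)) := by
  open Fucik in
  have hc : ∀ ε₁ ε₂ : Sgn,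
      Coeffs p q (fun t => ε₁.val * m t) (fun t => ε₂.val * n t) T₁ T₂ := fun ε₁ ε₂ =>
    (Coeffs.mk hp hq hm hn hp_pos).of_smul _ _
  have key : ∀ (σ τ ε₁ ε₂ : Sgn) (a b : ℝ),
      (a, b) ∈ curve T₁ T₂ p q m n τ (k + 1) ∩ quadrant ε₁ ε₂ →
      (∃ b', (a, b') ∈ curve T₁ T₂ p q m n σ k ∩ quadrant ε₁ ε₂) ∧
      ∀ b', (a, b') ∈ curve T₁ T₂ p q m n σ k → ε₂.val * b' < ε₂.val * b := by
    intro σ τ ε₁ ε₂ a b ⟨h, hQ⟩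
    rw [mem_quadrant_iff] at hQ
    obtain ⟨⟨b', hb', hmem⟩, hlt⟩ := curve_succ_above hT (hc ε₁ ε₂) hq_nonneg hk hQ.2
      ((mem_curve_val_iff ε₁ ε₂).2 h) σ
    refine ⟨⟨ε₂.val * b', ?_, ?_⟩, fun b' hb' => hlt _ ((mem_curve_val_iff ε₁ ε₂).2 hb')⟩
    · rwa [← mem_curve_val_iff ε₁ ε₂, ← mul_assoc, ε₂.val_mul_val, one_mul]
    · rw [mem_quadrant_iff, ← mul_assoc, ε₂.val_mul_val, one_mul]
      exact ⟨hQ.1, hb'⟩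
  refine ⟨fun ε₁ ε₂ => ⟨?_, ?_⟩, fun σ τ ε a b h => ?_, fun σ τ ε a b h => ?_⟩
  · rintro ⟨⟨⟨a₁, b₁⟩, h₁, hQ₁⟩, ⟨⟨a₂, b₂⟩, h₂, hQ₂⟩⟩
    rw [mem_quadrant_iff] at hQ₁ hQ₂
    obtain ⟨σ, a, b, ha, hb, h⟩ := exists_mem_curve_succ hT (hc ε₁ ε₂) hq_nonneg hk hQ₁.1 hQ₁.2
      hQ₂.1 hQ₂.2 ((mem_curve_val_iff ε₁ ε₂).2 h₁) ((mem_curve_val_iff ε₁ ε₂).2 h₂)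
    have hmem : (ε₁.val * a, ε₂.val * b) ∈ curve T₁ T₂ p q m n σ (k + 1) ∩ quadrant ε₁ ε₂ := by
      rw [Set.mem_inter_iff, ← mem_curve_val_iff ε₁ ε₂, mem_quadrant_iff, ← mul_assoc, ← mul_assoc,
        ε₁.val_mul_val, ε₂.val_mul_val, one_mul, one_mul]
      exact ⟨h, ha, hb⟩
    cases σ
    · exact Or.inl ⟨_, hmem⟩
    · exact Or.inr ⟨_, hmem⟩
  · rintro (⟨⟨a, b⟩, h⟩ | ⟨⟨a, b⟩, h⟩)
    · exact ⟨(key Sgn.pos _ ε₁ ε₂ a b h).1.imp' (fun b' => (a, b')) fun _ => id,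
        (key Sgn.neg _ ε₁ ε₂ a b h).1.imp' (fun b' => (a, b')) fun _ => id⟩
    · exact ⟨(key Sgn.pos _ ε₁ ε₂ a b h).1.imp' (fun b' => (a, b')) fun _ => id,
        (key Sgn.neg _ ε₁ ε₂ a b h).1.imp' (fun b' => (a, b')) fun _ => id⟩
  · obtain ⟨h1, h2⟩ := key σ τ ε Sgn.pos a b h
    exact ⟨h1, fun b' hb' => by simpa [Sgn.val] using h2 b' hb'.1⟩
  · obtain ⟨h1, h2⟩ := key σ τ ε Sgn.neg a b h
    exact ⟨h1, fun b' hb' => by simpa [Sgn.val] using h2 b' hb'.1⟩
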